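/- Let $4\le N\le 10$, let $\mathbb S^{N-1}$ be the unit sphere of $\mathbb R^N$ with its Laplace--Beltrami operator $\Delta_{\mathbb S^{N-1}}$, fix a point $p\in\mathbb S^{N-1}$ (the north pole), and let $\theta(\sigma)\in[0,\pi]$ be the geodesic distance from $p$ to $\sigma\in\mathbb S^{N-1}$. Then the equation $$\Delta_{\mathbb S^{N-1}}V+2(N-2)(e^V-1)=0\quad\text{on }\mathbb S^{N-1}$$ has a countably infinite family of nonconstant solutions that are axially symmetric about the axis through $p$. More precisely, there are a strictly increasing sequence of real numbers $\alpha_j\to\infty$, functions $v_j:[0,\pi]\to\mathbb R$ of class $C^2(0,\pi)\cap C^1[0,\pi]$, and pairwise distinct nonconstant functions $V_j\in C^2(\mathbb S^{N-1})$ $(j\in\mathbb N)$ such that, for every $j$, $V_j$ solves the equation, $V_j(\sigma)=v_j(\theta(\sigma))$ for all $\sigma\in\mathbb S^{N-1}$, $v_j(\pi-\theta)=v_j(\theta)$ for all $\theta\in[0,\pi]$, and $$v_j''+(N-2)\frac{\cos\theta}{\sin\theta}\,v_j'+2(N-2)(e^{v_j}-1)=0\ \ (0<\theta<\pi),\qquad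 v_j(0)=\alpha_j,\qquad v_j'(0)=v_j'(\pi)=0.$$ -/

import Mathlib

open scoped Manifold

/-- The `N`-dimensional Euclidean space has dimension `(N - 1) + 1` when `N ≠ 0`; this makes Mathlib's
manifold structure on the unit sphere of `ℝ^N`, modelled on `ℝ^(N-1)`, available. -/
instance factFinrankEuclidean (N : ℕ) [NeZero N] :
    Fact (Module.finrank ℝ (EuclideanSpace ℝ (Fin N)) = (N - 1) + 1) :=
  ⟨by rw [finrank_euclideanSpace_fin, Nat.sub_add_cancel (NeZero.one_le)]⟩

/-- The unit sphere `S^(N-1)` of `ℝ^N`. -/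
abbrev UnitSphere (N : ℕ) : Type := Metric.sphere (0 : EuclideanSpace ℝ (Fin N)) 1

open Classical in
/-- The extension of a function on the sphere that is constant along rays, `y ↦ V (y / |y|)`
(the value at the origin is immaterial). -/
noncomputable def homogeneousExtension {N : ℕ} (V : UnitSphere N → ℝ)
    (y : EuclideanSpace ℝ (Fin N)) : ℝ :=
  if hy : y ≠ 0 then
    V ⟨‖y‖⁻¹ • y, by simp [norm_smul, inv_mul_cancel₀ (norm_ne_zero_iff.mpr hy)]⟩
  else 0

/-- The Laplace–Beltrami operator of the round sphere: the Euclidean Laplacian of the extension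
`y ↦ V (y / |y|)`, evaluated on the sphere. -/
noncomputable def sphereLaplacian {N : ℕ} (V : UnitSphere N → ℝ) (σ : UnitSphere N) : ℝ :=
  Laplacian.laplacian (homogeneousExtension V) (σ : EuclideanSpace ℝ (Fin N))

/-- `V` is a classical solution of `Δ V + 2 (N - 2) (e^V - 1) = 0` on `S^(N-1)`. -/
structure IsSphereSolution (N : ℕ) [NeZero N] (V : UnitSphere N → ℝ) : Prop where
  contMDiff : ContMDiff (𝓡 (N - 1)) 𝓘(ℝ, ℝ) 2 V
  equation : ∀ σ : UnitSphere N,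
    sphereLaplacian V σ + 2 * ((N : ℝ) - 2) * (Real.exp (V σ) - 1) = 0

/-- The polar angle of `σ` with respect to the north pole `p`, i.e. the geodesic distance from `p`
to `σ` on the unit sphere. -/
noncomputable def polarAngle {N : ℕ} (p σ : UnitSphere N) : ℝ :=
  InnerProductGeometry.angle (p : EuclideanSpace ℝ (Fin N)) (σ : EuclideanSpace ℝ (Fin N))

/-- `v ∈ C²(0, π) ∩ C¹[0, π]` solves
`v'' + (N - 2) (cos θ / sin θ) v' + 2 (N - 2) (e^v - 1) = 0` on `(0, π)`, `v'(0) = v'(π) = 0`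
(one-sided derivatives at the end points). -/
structure IsProfileSolution (N : ℕ) (v : ℝ → ℝ) : Prop where
  contDiffOn_one : ContDiffOn ℝ 1 v (Set.Icc 0 Real.pi)
  contDiffOn_two : ContDiffOn ℝ 2 v (Set.Ioo 0 Real.pi)
  equation : ∀ θ ∈ Set.Ioo 0 Real.pi,
    deriv (deriv v) θ + ((N : ℝ) - 2) * (Real.cos θ / Real.sin θ) * deriv v θ
      + 2 * ((N : ℝ) - 2) * (Real.exp (v θ) - 1) = 0
  deriv_zero : HasDerivWithinAt v 0 (Set.Icc 0 Real.pi) 0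
  deriv_pi : HasDerivWithinAt v 0 (Set.Icc 0 Real.pi) Real.pi

/-! Write `N = m + 3`, so that `1 ≤ m ≤ 7`. The profile equation has the explicit singular solution
`log (m / ((m + 1) sin² θ))`. In the variable `t = log (tan (θ / 2))`, the difference `w` between a
profile and this solution satisfies the damped equation `w'' + m cos θ w' + 2 m (exp w - 1) = 0`,
and `t ≤ 0` is one hemisphere. As `t → -∞` the linearisation at `w = 0` is `w'' + m w' + 2 m w = 0`;
for `m > 0` its roots are non-real exactly when `m < 8`, so small orbits spiral around the origin of
the phase plane.

A profile that is regular at the pole with value `α` there has, near the time `-α / 2`, a negative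
`w` and an energy bounded independently of `α`. The damping makes the energy small within a time
independent of `α` (`exists_time_emdenEnergy_le`), and from then until `t = 0` the orbit turns with
speed at least `1 / 20` (`le_phaseSpeed`). The total angle at `t = 0` therefore grows without bound
with `α`. It is continuous in `α`, so the intermediate value theorem gives arbitrarily large `α` for
which it is a multiple of `π`, which means `w' = 0` on the equator
(`exists_emden_family_snd_eq_zero`). Since `cos θ = 0` there, the profile itself is critical on the
equator, and its even reflection solves the equation on the whole sphere
(`exists_isLatitudeProfile`).

The regular profiles are built in `y = tan² (θ / 2)`, where the equation is a singular Volterra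
equation (`exists_volterra_family`). The nonlinearity is truncated to be Lipschitz, and an energy
argument shows that the truncation is never felt (`exists_liouville_family`). The passage to the
sphere is the computation of the Laplacian of a function of latitude (`sphereLaplacian_latitude`).
-/

open Set Filter Topology

/-! ### Singular Volterra equations. -/

/-- The average `∫₀¹ rⁿ g(y r²) dr` is differentiable in `y`. -/
theorem hasDerivAt_integral_pow_mul_comp_sq {g g' : ℝ → ℝ} (n : ℕ)
    (hg : ∀ x, HasDerivAt g (g' x) x) (hg' : Continuous g') (y : ℝ) :
    HasDerivAt (fun y => ∫ r in (0 : ℝ)..1, r ^ n * g (y * r ^ 2))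
      (∫ r in (0 : ℝ)..1, r ^ (n + 2) * g' (y * r ^ 2)) y := by
  have hgc : Continuous g := continuous_iff_continuousAt.2 fun x => (hg x).continuousAt
  obtain ⟨C, hC⟩ := (isCompact_Icc (a := -(|y| + 1)) (b := |y| + 1)).exists_bound_of_continuousOn
    hg'.continuousOn
  refine (intervalIntegral.hasDerivAt_integral_of_dominated_loc_of_deriv_le
    (F' := fun y r => r ^ (n + 2) * g' (y * r ^ 2)) (bound := fun _ => C)
    (Metric.ball_mem_nhds y one_pos) ?_ ?_ ?_ ?_ ?_ ?_).2
  · exact .of_forall fun x => Continuous.aestronglyMeasurable (by fun_prop)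
  · exact Continuous.intervalIntegrable (by fun_prop) _ _
  · exact Continuous.aestronglyMeasurable (by fun_prop)
  · refine .of_forall fun r hr x hx => ?_
    rw [uIoc_of_le zero_le_one] at hr
    have hx' : |x| ≤ |y| + 1 := by
      have h1 : |x - y| < 1 := by simpa [Real.dist_eq] using hx
      have h2 := abs_sub_abs_le_abs_sub x y
      linarith
    have hr2 : r ^ 2 ≤ 1 := pow_le_one₀ hr.1.le hr.2
    have hxr : |x * r ^ 2| ≤ |y| + 1 := by
      rw [abs_mul, abs_of_nonneg (sq_nonneg r)]
      nlinarith [abs_nonneg x, sq_nonneg r]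
    rw [norm_mul, Real.norm_of_nonneg (pow_nonneg hr.1.le _)]
    have h3 := hC _ (abs_le.1 hxr)
    have h4 : r ^ (n + 2) ≤ 1 := pow_le_one₀ hr.1.le hr.2
    nlinarith [norm_nonneg (g' (x * r ^ 2)), pow_nonneg hr.1.le (n + 2)]
  · exact continuous_const.intervalIntegrable _ _
  · refine .of_forall fun r _ x _ => ?_
    have h1 : HasDerivAt (fun x : ℝ => x * r ^ 2) (r ^ 2) x := by
      simpa using (hasDerivAt_id x).mul_const (r ^ 2)
    have h2 := ((hg (x * r ^ 2)).comp x h1).const_mul (r ^ n)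
    refine h2.congr_deriv ?_
    ring

/-- Integrate the `r`-derivative of `r ^ (n + 1) * g (y * r ^ 2)` over `[0, 1]`. This turns the
integral formula for a solution back into the differential equation without dividing by `y`. -/
theorem integral_pow_mul_comp_sq_identity {g g' : ℝ → ℝ} (n : ℕ)
    (hg : ∀ x, HasDerivAt g (g' x) x) (hg' : Continuous g') (y : ℝ) :
    2 * y * (∫ r in (0 : ℝ)..1, r ^ (n + 2) * g' (y * r ^ 2))
      + (n + 1) * (∫ r in (0 : ℝ)..1, r ^ n * g (y * r ^ 2)) = g y := by
  have hgc : Continuous g := continuous_iff_continuousAt.2 fun x => (hg x).continuousAt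
  have hd : ∀ r ∈ uIcc (0 : ℝ) 1, HasDerivAt (fun r : ℝ => r ^ (n + 1) * g (y * r ^ 2))
      (2 * y * (r ^ (n + 2) * g' (y * r ^ 2)) + (n + 1) * (r ^ n * g (y * r ^ 2))) r := by
    intro r _
    have h1 : HasDerivAt (fun r : ℝ => y * r ^ 2) (y * (2 * r)) r := by
      simpa using (hasDerivAt_pow 2 r).const_mul y
    have h2 := (hasDerivAt_pow (n + 1) r).mul ((hg (y * r ^ 2)).comp r h1)
    refine h2.congr_deriv ?_
    simp
    ring
  have hi := intervalIntegral.integral_eq_sub_of_hasDerivAt hd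
    (Continuous.intervalIntegrable (by fun_prop) _ _)
  rw [intervalIntegral.integral_add (Continuous.intervalIntegrable (by fun_prop) _ _)
    (Continuous.intervalIntegrable (by fun_prop) _ _), intervalIntegral.integral_const_mul,
    intervalIntegral.integral_const_mul] at hi
  simpa using hi

/-- The gain `1 / L` over the weight itself is what makes the Volterra operator a contraction in a
weighted norm. -/
theorem abs_integral_exp_abs_le {L : ℝ} (hL : 0 < L) (y : ℝ) :
    |∫ z in (0 : ℝ)..y, Real.exp (L * |z|)| ≤ Real.exp (L * |y|) / L := by
  have key : ∀ y : ℝ, 0 ≤ y → |∫ z in (0 : ℝ)..y, Real.exp (L * |z|)| ≤ Real.exp (L * |y|) / L := by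
    intro y hy
    have h1 : (∫ z in (0 : ℝ)..y, Real.exp (L * |z|)) = ∫ z in (0 : ℝ)..y, Real.exp (L * z) := by
      refine intervalIntegral.integral_congr fun z hz => ?_
      rw [uIcc_of_le hy] at hz
      simp only [abs_of_nonneg hz.1]
    have h2 : (∫ z in (0 : ℝ)..y, Real.exp (L * z)) = (Real.exp (L * y) - 1) / L := by
      rw [intervalIntegral.integral_comp_mul_left _ hL.ne']
      simp
      ring
    have h3 : 1 ≤ Real.exp (L * y) := Real.one_le_exp (by positivity)
    rw [h1, h2, abs_of_nonneg hy, abs_of_nonneg (div_nonneg (by linarith) hL.le)]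
    gcongr
    linarith
  rcases le_total 0 y with hy | hy
  · exact key y hy
  · have h1 := key (-y) (by linarith)
    have h2 := intervalIntegral.integral_comp_neg (a := 0) (b := -y)
      (fun z => Real.exp (L * |z|))
    simp only [abs_neg, neg_neg, neg_zero] at h2
    rw [h2, intervalIntegral.integral_symm, abs_neg, abs_neg] at h1
    exact h1

theorem continuous_uncurry_integral_comp_sq {X : Type*} [TopologicalSpace X] (n : ℕ)
    {κ φ : ℝ → ℝ} (hκ : Continuous κ) (hφ : Continuous φ) {u : X → ℝ → ℝ}
    (hu : Continuous (Function.uncurry u)) :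
    Continuous (fun q : X × ℝ =>
      ∫ r in (0 : ℝ)..1, r ^ n * (κ (q.2 * r ^ 2) * φ (u q.1 (q.2 * r ^ 2)))) := by
  apply intervalIntegral.continuous_parametric_intervalIntegral_of_continuous'
  have : Continuous fun p : (X × ℝ) × ℝ => u p.1.1 (p.1.2 * p.2 ^ 2) :=
    hu.comp (f := fun p : (X × ℝ) × ℝ => (p.1.1, p.1.2 * p.2 ^ 2)) (by fun_prop)
  unfold Function.uncurry
  fun_prop

/-- A singular Volterra equation with Lipschitz nonlinearity has solutions on `[-1, 2]` which
depend continuously on the initial value. -/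
theorem exists_continuous_volterra_family (n : ℕ) {k κ φ : ℝ → ℝ} (hk : Continuous k)
    (hκ : Continuous κ) {K : NNReal} (hφ : LipschitzWith K φ) :
    ∃ H : ℝ → ℝ → ℝ, Continuous (Function.uncurry H) ∧
      ∀ α, ∀ y ∈ Icc (-1 : ℝ) 2, H α y = α + ∫ z in (0 : ℝ)..y,
        k z * ∫ r in (0 : ℝ)..1, r ^ n * (κ (z * r ^ 2) * φ (H α (z * r ^ 2))) := by
  have h12 : (-1 : ℝ) ≤ 2 := by norm_num
  obtain ⟨C₁, hC₁⟩ := (isCompact_Icc (a := (-1 : ℝ)) (b := 2)).exists_bound_of_continuousOn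
    hk.continuousOn
  obtain ⟨C₂, hC₂⟩ := (isCompact_Icc (a := (-1 : ℝ)) (b := 2)).exists_bound_of_continuousOn
    hκ.continuousOn
  have hC₁0 : 0 ≤ C₁ := (norm_nonneg _).trans (hC₁ 0 (by norm_num))
  have hC₂0 : 0 ≤ C₂ := (norm_nonneg _).trans (hC₂ 0 (by norm_num))
  -- The contraction factor will be `C₁ C₂ K / L`, which this choice keeps below `1 / 2`.
  set L : ℝ := 2 * (C₁ * C₂ * K + 1) with hLdef
  have hL : 0 < L := by positivity
  have hφc := hφ.continuous
  let X := C(Icc (-1 : ℝ) 2, ℝ)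
  -- The unknown is `u = exp (-L |z|) H`: the sup norm of `u` is an exponentially weighted norm of
  -- `H`, in which one contraction covers all of `[-1, 2]`.
  let ext : X → ℝ → ℝ := fun u z => Real.exp (L * |z|) * IccExtend h12 u z
  have hextc : Continuous (Function.uncurry ext) := by
    have h1 : Continuous fun p : X × ℝ => p.1 (projIcc (-1 : ℝ) 2 h12 p.2) := by
      have := continuous_projIcc (h := h12)
      fun_prop
    have : Function.uncurry ext = fun p : X × ℝ =>
      Real.exp (L * |p.2|) * p.1 (projIcc (-1 : ℝ) 2 h12 p.2) := rfl
    rw [this]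
    fun_prop
  let J : X → ℝ → ℝ := fun u z =>
    ∫ r in (0 : ℝ)..1, r ^ n * (κ (z * r ^ 2) * φ (ext u (z * r ^ 2)))
  have hJ : Continuous (Function.uncurry J) := continuous_uncurry_integral_comp_sq n hκ hφc hextc
  have hJu : ∀ u, Continuous (J u) := fun u => hJ.comp (f := fun z => (u, z)) (by fun_prop)
  have hprim : ∀ u, Continuous fun y => ∫ z in (0 : ℝ)..y, k z * J u z := fun u =>
    intervalIntegral.continuous_primitive
      (fun a b => (hk.mul (hJu u)).intervalIntegrable a b) 0
  let T : ℝ → X → X := fun α u =>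
    ⟨fun y => Real.exp (-(L * |(y : ℝ)|)) * (α + ∫ z in (0 : ℝ)..y, k z * J u z), by
      have := (hprim u).comp (continuous_subtype_val (p := fun x => x ∈ Icc (-1 : ℝ) 2))
      fun_prop⟩
  have hsub : ∀ z ∈ Icc (-1 : ℝ) 2, ∀ r ∈ Icc (0 : ℝ) 1, z * r ^ 2 ∈ Icc (-1 : ℝ) 2 := by
    intro z hz r hr
    have h1 : r ^ 2 ≤ 1 := pow_le_one₀ hr.1 hr.2
    constructor <;> nlinarith [hz.1, hz.2, sq_nonneg r]
  have hJdist : ∀ u v : X, ∀ z ∈ Icc (-1 : ℝ) 2,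
      |J u z - J v z| ≤ C₂ * K * dist u v * Real.exp (L * |z|) := by
    intro u v z hz
    have hint : ∀ u : X, IntervalIntegrable
        (fun r => r ^ n * (κ (z * r ^ 2) * φ (ext u (z * r ^ 2)))) MeasureTheory.volume 0 1 := by
      intro u
      have : Continuous (ext u) := hextc.comp (f := fun z => (u, z)) (by fun_prop)
      exact Continuous.intervalIntegrable (by fun_prop) _ _
    rw [← intervalIntegral.integral_sub (hint u) (hint v)]
    suffices h : ∀ r ∈ uIoc (0 : ℝ) 1, ‖r ^ n * (κ (z * r ^ 2) * φ (ext u (z * r ^ 2))) -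
        r ^ n * (κ (z * r ^ 2) * φ (ext v (z * r ^ 2)))‖ ≤
        C₂ * K * dist u v * Real.exp (L * |z|) by
      simpa using intervalIntegral.norm_integral_le_of_norm_le_const h
    intro r hr
    rw [uIoc_of_le zero_le_one] at hr
    have hr' : r ∈ Icc (0 : ℝ) 1 := ⟨hr.1.le, hr.2⟩
    have hz' := hsub z hz r hr'
    have e1 : |φ (ext u (z * r ^ 2)) - φ (ext v (z * r ^ 2))| ≤
        K * (Real.exp (L * |z|) * dist u v) := by
      have h1 := hφ.dist_le_mul (ext u (z * r ^ 2)) (ext v (z * r ^ 2))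
      rw [Real.dist_eq] at h1
      refine h1.trans (mul_le_mul_of_nonneg_left ?_ K.2)
      simp only [ext, Real.dist_eq]
      rw [← mul_sub, abs_mul, abs_of_pos (Real.exp_pos _)]
      have h2 : |IccExtend h12 u (z * r ^ 2) - IccExtend h12 v (z * r ^ 2)| ≤ dist u v := by
        rw [← Real.dist_eq]
        exact ContinuousMap.dist_apply_le_dist _
      have h3 : |z * r ^ 2| ≤ |z| := by
        rw [abs_mul, abs_of_nonneg (sq_nonneg r)]
        exact mul_le_of_le_one_right (abs_nonneg _) (pow_le_one₀ hr'.1 hr'.2)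
      gcongr
    have e2 : |r ^ n| ≤ 1 := by
      rw [abs_of_nonneg (pow_nonneg hr'.1 _)]
      exact pow_le_one₀ hr'.1 hr'.2
    have e3 := hC₂ _ hz'
    rw [Real.norm_eq_abs] at e3 ⊢
    rw [← mul_sub, ← mul_sub, abs_mul, abs_mul]
    calc |r ^ n| * (|κ (z * r ^ 2)| * |φ (ext u (z * r ^ 2)) - φ (ext v (z * r ^ 2))|)
        ≤ 1 * (C₂ * (K * (Real.exp (L * |z|) * dist u v))) := by gcongr
      _ = _ := by ring
  have hTdist : ∀ α, ∀ u v : X, dist (T α u) (T α v) ≤ 1 / 2 * dist u v := by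
    intro α u v
    refine (ContinuousMap.dist_le (by positivity)).2 fun y => ?_
    have hy := y.2
    have hint : ∀ u : X, IntervalIntegrable (fun z => k z * J u z) MeasureTheory.volume 0 y :=
      fun u => (hk.mul (hJu u)).intervalIntegrable _ _
    simp only [T, ContinuousMap.coe_mk, Real.dist_eq]
    rw [← mul_sub, abs_mul, abs_of_pos (Real.exp_pos _), add_sub_add_left_eq_sub,
      ← intervalIntegral.integral_sub (hint u) (hint v)]
    have h1 : ‖∫ z in (0 : ℝ)..y, (k z * J u z - k z * J v z)‖ ≤
        |∫ z in (0 : ℝ)..y, C₁ * (C₂ * K * dist u v) * Real.exp (L * |z|)| := by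
      refine intervalIntegral.norm_integral_le_abs_of_norm_le ?_
        (Continuous.intervalIntegrable (by fun_prop) _ _)
      refine (MeasureTheory.ae_restrict_iff' measurableSet_uIoc).2 (.of_forall fun z hz => ?_)
      have hz' : z ∈ Icc (-1 : ℝ) 2 := by
        have := uIoc_subset_uIcc hz
        exact (uIcc_subset_Icc (by norm_num) hy) this
      rw [← mul_sub, norm_mul, Real.norm_eq_abs (J u z - J v z), mul_assoc C₁]
      have := hC₁ z hz'
      have := hJdist u v z hz'
      gcongr
    rw [intervalIntegral.integral_const_mul, abs_mul, Real.norm_eq_abs,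
      abs_of_nonneg (a := C₁ * (C₂ * K * dist u v)) (by positivity)] at h1
    have h2 := abs_integral_exp_abs_le hL (y : ℝ)
    have h3 : Real.exp (-(L * |(y : ℝ)|)) * Real.exp (L * |(y : ℝ)|) = 1 := by
      rw [← Real.exp_add]; simp
    calc Real.exp (-(L * |(y : ℝ)|)) * |∫ z in (0 : ℝ)..y, (k z * J u z - k z * J v z)|
        ≤ Real.exp (-(L * |(y : ℝ)|)) * (C₁ * (C₂ * K * dist u v) *
          (Real.exp (L * |(y : ℝ)|) / L)) := by
          gcongr
          exact h1.trans (by gcongr)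
      _ = (Real.exp (-(L * |(y : ℝ)|)) * Real.exp (L * |(y : ℝ)|)) *
          (C₁ * C₂ * K / L) * dist u v := by ring
      _ ≤ 1 / 2 * dist u v := by
          rw [h3, one_mul]
          refine mul_le_mul_of_nonneg_right ?_ dist_nonneg
          rw [div_le_iff₀ hL, hLdef]
          nlinarith
  have hT : ∀ α, ContractingWith (1 / 2) (T α) := fun α =>
    ⟨by
      rw [← NNReal.coe_lt_coe]
      norm_num, LipschitzWith.of_dist_le_mul fun u v => by simpa using hTdist α u v⟩
  let U : ℝ → X := fun α => ContractingWith.fixedPoint (T α) (hT α)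
  have hU : ∀ α, T α (U α) = U α := fun α => (hT α).fixedPoint_isFixedPt
  have hUc : Continuous U := by
    -- The operators for `α` and `β` differ by at most `|α - β|`, and the contraction factor `1 / 2`
    -- doubles this for the fixed points.
    have : LipschitzWith 2 U := by
      refine LipschitzWith.of_dist_le_mul fun α β => ?_
      have h := (hT α).fixedPoint_lipschitz_in_map (hT β) (C := dist α β) ?_
      · refine h.trans (le_of_eq ?_)
        simp
        ring
      · intro u
        refine (ContinuousMap.dist_le dist_nonneg).2 fun y => ?_
        simp only [T, ContinuousMap.coe_mk, Real.dist_eq]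
        rw [← mul_sub, abs_mul, abs_of_pos (Real.exp_pos _), add_sub_add_right_eq_sub]
        refine mul_le_of_le_one_left (abs_nonneg _) (Real.exp_le_one_iff.2 ?_)
        have : 0 ≤ L * |(y : ℝ)| := by positivity
        linarith
    exact this.continuous
  refine ⟨fun α y => ext (U α) y, ?_, fun α y hy => ?_⟩
  · exact hextc.comp (f := fun p : ℝ × ℝ => (U p.1, p.2)) (by fun_prop)
  · have h1 : IccExtend h12 (U α) y = U α ⟨y, hy⟩ := IccExtend_of_mem _ _ hy
    have h2 : U α ⟨y, hy⟩ =
        Real.exp (-(L * |y|)) * (α + ∫ z in (0 : ℝ)..y, k z * J (U α) z) := by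
      conv_lhs => rw [← hU α]
      rfl
    have h3 : Real.exp (L * |y|) * Real.exp (-(L * |y|)) = 1 := by
      rw [← Real.exp_add]; simp
    change Real.exp (L * |y|) * IccExtend h12 (U α) y = _
    rw [h1, h2, ← mul_assoc, h3, one_mul]

/-- The solutions of the singular Volterra equation are `C¹` and satisfy the differentiated
equation. -/
theorem exists_volterra_family (n : ℕ) {k κ φ : ℝ → ℝ} (hk : Continuous k)
    (hκ : Continuous κ) {K : NNReal} (hφ : LipschitzWith K φ) :
    ∃ H : ℝ → ℝ → ℝ, Continuous (Function.uncurry H) ∧ (∀ α, H α 0 = α) ∧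
      (∀ α, ContDiff ℝ 1 (H α)) ∧
      ∀ α, ∀ y ∈ Ioo (-1 : ℝ) 2, HasDerivAt (H α)
        (k y * ∫ r in (0 : ℝ)..1, r ^ n * (κ (y * r ^ 2) * φ (H α (y * r ^ 2)))) y := by
  obtain ⟨H₀, hH₀c, hH₀⟩ := exists_continuous_volterra_family n hk hκ hφ
  have hφc := hφ.continuous
  let J : ℝ → ℝ → ℝ := fun α z =>
    ∫ r in (0 : ℝ)..1, r ^ n * (κ (z * r ^ 2) * φ (H₀ α (z * r ^ 2)))
  have hJ : Continuous (Function.uncurry J) := continuous_uncurry_integral_comp_sq n hκ hφc hH₀c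
  have hJa : ∀ α, Continuous (J α) := fun α => hJ.comp (f := fun z => (α, z)) (by fun_prop)
  -- `H₀` solves the equation only on `[-1, 2]`; taking the right-hand side as the definition gives
  -- a function that is `C¹` on the whole line.
  let H : ℝ → ℝ → ℝ := fun α y => α + ∫ z in (0 : ℝ)..y, k z * J α z
  have hHd : ∀ α y, HasDerivAt (H α) (k y * J α y) y := by
    intro α y
    have hc : Continuous fun z => k z * J α z := hk.mul (hJa α)
    exact (intervalIntegral.integral_hasDerivAt_right (hc.intervalIntegrable _ _)
      (hc.stronglyMeasurableAtFilter _ _) hc.continuousAt).const_add α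
  have hHeq : ∀ α, ∀ y ∈ Icc (-1 : ℝ) 2, H α y = H₀ α y := fun α y hy => (hH₀ α y hy).symm
  refine ⟨H, ?_, fun α => by simp [H], fun α => ?_, fun α y hy => ?_⟩
  · have h1 : Continuous fun p : ℝ × ℝ => ∫ z in (0 : ℝ)..p.2, k z * J p.1 z := by
      refine intervalIntegral.continuous_parametric_intervalIntegral_of_continuous
        (f := fun (p : ℝ × ℝ) z => k z * J p.1 z) ?_ continuous_snd
      have : Continuous fun p : (ℝ × ℝ) × ℝ => J p.1.1 p.2 :=
        hJ.comp (f := fun p : (ℝ × ℝ) × ℝ => (p.1.1, p.2)) (by fun_prop)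
      unfold Function.uncurry
      fun_prop
    exact continuous_fst.add h1
  · rw [contDiff_one_iff_deriv]
    refine ⟨fun y => (hHd α y).differentiableAt, ?_⟩
    rw [show deriv (H α) = fun y => k y * J α y from funext fun y => (hHd α y).deriv]
    exact hk.mul (hJa α)
  · convert hHd α y using 2
    refine intervalIntegral.integral_congr fun r hr => ?_
    rw [uIcc_of_le zero_le_one] at hr
    have h1 : r ^ 2 ≤ 1 := pow_le_one₀ hr.1 hr.2
    have h2 : y * r ^ 2 ∈ Icc (-1 : ℝ) 2 := by
      constructor <;> nlinarith [hy.1, hy.2, sq_nonneg r]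
    simp only [hHeq α _ h2]

/-! ### Regular solutions in the stereographic variable `y = tan² (θ / 2)`. -/

/-- A smooth positive function on the line which equals `1 + z` for `z ≥ -1/2`. -/
noncomputable def stereoWeight (z : ℝ) : ℝ := 1 + z * Real.smoothTransition (2 + 2 * z)

theorem contDiff_stereoWeight : ContDiff ℝ 2 stereoWeight := by
  unfold stereoWeight
  have : ContDiff ℝ 2 Real.smoothTransition := Real.smoothTransition.contDiff (n := 2)
  fun_prop

theorem stereoWeight_of_le {z : ℝ} (hz : -1 / 2 ≤ z) : stereoWeight z = 1 + z := by
  rw [stereoWeight, Real.smoothTransition.one_of_one_le (by linarith), mul_one]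

theorem stereoWeight_pos (z : ℝ) : 0 < stereoWeight z := by
  unfold stereoWeight
  have h1 := Real.smoothTransition.nonneg (2 + 2 * z)
  have h2 := Real.smoothTransition.le_one (2 + 2 * z)
  rcases le_or_gt z (-1) with h | h
  · rw [Real.smoothTransition.zero_of_nonpos (by linarith)]; norm_num
  · rcases le_or_gt 0 z with h0 | h0
    · positivity
    · nlinarith

/-- The nonlinearity `2 (m + 1) (eᵛ - 1)`, continued linearly for `v ≥ L`. -/
noncomputable def liouvilleTrunc (m : ℕ) (L v : ℝ) : ℝ :=
  ∫ x in (0 : ℝ)..v, 2 * ((m : ℝ) + 1) * Real.exp (min x L)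

theorem hasDerivAt_liouvilleTrunc (m : ℕ) (L v : ℝ) :
    HasDerivAt (liouvilleTrunc m L) (2 * ((m : ℝ) + 1) * Real.exp (min v L)) v := by
  have hc : Continuous fun x : ℝ => 2 * ((m : ℝ) + 1) * Real.exp (min x L) := by fun_prop
  exact intervalIntegral.integral_hasDerivAt_right (hc.intervalIntegrable _ _)
      (hc.stronglyMeasurableAtFilter _ _) hc.continuousAt

theorem contDiff_liouvilleTrunc (m : ℕ) (L : ℝ) : ContDiff ℝ 1 (liouvilleTrunc m L) := by
  rw [contDiff_one_iff_deriv]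
  refine ⟨fun v => (hasDerivAt_liouvilleTrunc m L v).differentiableAt, ?_⟩
  rw [funext fun v => (hasDerivAt_liouvilleTrunc m L v).deriv]
  fun_prop

theorem exists_lipschitzWith_liouvilleTrunc (m : ℕ) (L : ℝ) :
    ∃ K, LipschitzWith K (liouvilleTrunc m L) := by
  refine ⟨(2 * ((m : ℝ) + 1) * Real.exp L).toNNReal,
    lipschitzWith_of_nnnorm_deriv_le
      (fun v => (hasDerivAt_liouvilleTrunc m L v).differentiableAt) fun v => ?_⟩
  rw [(hasDerivAt_liouvilleTrunc m L v).deriv, ← NNReal.coe_le_coe, coe_nnnorm,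
    Real.norm_of_nonneg (by positivity), Real.coe_toNNReal _ (by positivity)]
  gcongr
  exact min_le_right _ _

theorem liouvilleTrunc_of_le (m : ℕ) {L v : ℝ} (hL : 0 ≤ L) (hv : v ≤ L) :
    liouvilleTrunc m L v = 2 * ((m : ℝ) + 1) * (Real.exp v - 1) := by
  have h : liouvilleTrunc m L v = ∫ x in (0 : ℝ)..v, 2 * ((m : ℝ) + 1) * Real.exp x := by
    refine intervalIntegral.integral_congr fun x hx => ?_
    have : x ≤ L := (mem_uIcc.1 hx).elim (fun h => h.2.trans hv) fun h => h.2.trans hL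
    simp only [min_eq_left this]
  rw [h, intervalIntegral.integral_const_mul, integral_exp, Real.exp_zero]

theorem liouvilleTrunc_pos (m : ℕ) (L : ℝ) {v : ℝ} (hv : 0 < v) : 0 < liouvilleTrunc m L v :=
  intervalIntegral.intervalIntegral_pos_of_pos
    (Continuous.intervalIntegrable (by fun_prop) _ _) (fun x => by positivity) hv

/-- In divergence form the equation reads `(y^(m/2+1) (1+y)^(-m) H')' = -y^(m/2) (1+y)^(-m-2) φ(H)`.
Integrating from `0` and substituting `y r²` gives a Volterra equation that is smooth at `y = 0`.
`stereoWeight` stands for `1 + y`, to avoid the pole at `y = -1`; negative `y` is admitted to have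
two-sided derivatives at `y = 0`. -/
theorem exists_truncated_family (m : ℕ) (L : ℝ) :
    ∃ H H1 : ℝ → ℝ → ℝ, Continuous (Function.uncurry H) ∧ Continuous (Function.uncurry H1) ∧
      (∀ α, H α 0 = α) ∧
      (∀ α C, (∀ y ∈ Icc (0 : ℝ) 1, |liouvilleTrunc m L (H α y)| ≤ C) →
        ∀ y ∈ Icc (0 : ℝ) 1, |H1 α y| ≤ 2 ^ (m + 1) * C) ∧
      ∀ α, ∃ H2 : ℝ → ℝ, Continuous H2 ∧ ∀ y ∈ Ioo (-1 / 2 : ℝ) 2,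
        HasDerivAt (H α) (H1 α y) y ∧ HasDerivAt (H1 α) (H2 y) y ∧
        y * (1 + y) ^ 2 * H2 y + (1 + y) ^ 2 * H1 α y + m / 2 * (1 - y ^ 2) * H1 α y
          + liouvilleTrunc m L (H α y) = 0 := by
  obtain ⟨K, hK⟩ := exists_lipschitzWith_liouvilleTrunc m L
  have hDs := contDiff_stereoWeight
  have hD0 := stereoWeight_pos
  have hDc := hDs.continuous
  have hφ := contDiff_liouvilleTrunc m L
  set φ := liouvilleTrunc m L
  set κ : ℝ → ℝ := fun z => (stereoWeight z ^ (m + 2))⁻¹ with hκdef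
  have hκs : ContDiff ℝ 1 κ := by
    have : ContDiff ℝ 1 stereoWeight := hDs.of_le (by norm_num)
    exact (this.pow _).inv fun z => (pow_pos (hD0 z) _).ne'
  have hk : Continuous fun z => -2 * stereoWeight z ^ m := by fun_prop
  obtain ⟨H, hHc, hH0, hHs, hHd⟩ := exists_volterra_family (m + 1) hk hκs.continuous hK
  have hφc := hφ.continuous
  set J : ℝ → ℝ → ℝ := fun α z =>
    ∫ r in (0 : ℝ)..1, r ^ (m + 1) * (κ (z * r ^ 2) * φ (H α (z * r ^ 2))) with hJdef
  have hJ : Continuous (Function.uncurry J) :=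
    continuous_uncurry_integral_comp_sq (m + 1) hκs.continuous hφc hHc
  refine ⟨H, fun α y => -2 * stereoWeight y ^ m * J α y, hHc, ?_, hH0, ?_, fun α => ?_⟩
  · have h1 : Continuous fun p : ℝ × ℝ => -2 * stereoWeight p.2 ^ m := by fun_prop
    exact h1.mul hJ
  · intro α C hC y hy
    have hC0 : 0 ≤ C := (abs_nonneg _).trans (hC 0 (by norm_num))
    have hJb : |J α y| ≤ C := by
      suffices h : ∀ r ∈ uIoc (0 : ℝ) 1,
          ‖r ^ (m + 1) * (κ (y * r ^ 2) * φ (H α (y * r ^ 2)))‖ ≤ C by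
        simpa using intervalIntegral.norm_integral_le_of_norm_le_const h
      intro r hr
      rw [uIoc_of_le zero_le_one] at hr
      have hr2 : r ^ 2 ≤ 1 := pow_le_one₀ hr.1.le hr.2
      have hyr : y * r ^ 2 ∈ Icc (0 : ℝ) 1 :=
        ⟨mul_nonneg hy.1 (sq_nonneg r), mul_le_one₀ hy.2 (sq_nonneg r) hr2⟩
      have hκ1 : κ (y * r ^ 2) ≤ 1 := by
        simp only [hκdef]
        rw [stereoWeight_of_le (by linarith [hyr.1])]
        exact inv_le_one_of_one_le₀ (one_le_pow₀ (by linarith [hyr.1]))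
      have hκ0 : 0 ≤ κ (y * r ^ 2) := (inv_pos.2 (pow_pos (hD0 _) _)).le
      rw [norm_mul, norm_mul, Real.norm_of_nonneg (pow_nonneg hr.1.le _),
        Real.norm_of_nonneg hκ0]
      calc r ^ (m + 1) * (κ (y * r ^ 2) * ‖φ (H α (y * r ^ 2))‖) ≤ 1 * (1 * C) := by
            gcongr
            · exact pow_le_one₀ hr.1.le hr.2
            · exact hC _ hyr
        _ = C := by ring
    beta_reduce
    rw [stereoWeight_of_le (by linarith [hy.1]), abs_mul, abs_mul, abs_neg, abs_two,
      abs_of_nonneg (pow_nonneg (by linarith [hy.1]) m), pow_succ, mul_comm (2 ^ m) (2 : ℝ)]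
    have : (1 + y) ^ m ≤ 2 ^ m := pow_le_pow_left₀ (by linarith [hy.1]) (by linarith [hy.2]) m
    gcongr
  · set g : ℝ → ℝ := fun z => κ z * φ (H α z) with hgdef
    have hgs : ContDiff ℝ 1 g := hκs.mul (hφ.comp (hHs α))
    have hgd : ∀ x, HasDerivAt g (deriv g x) x := fun x =>
      (hgs.differentiable one_ne_zero x).hasDerivAt
    have hgc : Continuous (deriv g) := hgs.continuous_deriv le_rfl
    set J1 : ℝ → ℝ := fun y => ∫ r in (0 : ℝ)..1, r ^ (m + 1 + 2) * deriv g (y * r ^ 2)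
      with hJ1def
    have hJd : ∀ y, HasDerivAt (J α) (J1 y) y := fun y =>
      hasDerivAt_integral_pow_mul_comp_sq (m + 1) hgd hgc y
    have hJ1c : Continuous J1 :=
      intervalIntegral.continuous_parametric_intervalIntegral_of_continuous'
        (by unfold Function.uncurry; fun_prop) _ _
    have hDd : ∀ y, HasDerivAt stereoWeight (deriv stereoWeight y) y := fun y =>
      (hDs.differentiable two_ne_zero y).hasDerivAt
    have hDdc : Continuous (deriv stereoWeight) := hDs.continuous_deriv (by norm_num)
    refine ⟨fun y => -2 * (m * stereoWeight y ^ (m - 1) * deriv stereoWeight y) * J α y +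
      -2 * stereoWeight y ^ m * J1 y, ?_, fun y hy => ⟨?_, ?_, ?_⟩⟩
    · have : Continuous (J α) := hJ.comp (f := fun z => (α, z)) (by fun_prop)
      fun_prop
    · exact hHd α y ⟨by linarith [hy.1], hy.2⟩
    · exact (((hDd y).pow m).const_mul (-2)).mul (hJd y)
    · have hid := integral_pow_mul_comp_sq_identity (m + 1) hgd hgc y
      change 2 * y * J1 y + ((m + 1 : ℕ) + 1) * J α y = κ y * φ (H α y) at hid
      have hD1 : deriv stereoWeight y = 1 := by
        have : stereoWeight =ᶠ[𝓝 y] fun z => 1 + z := by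
          filter_upwards [Ioi_mem_nhds hy.1] with z hz using stereoWeight_of_le (le_of_lt hz)
        rw [this.deriv_eq]
        simp
      have hDy : stereoWeight y = 1 + y := stereoWeight_of_le hy.1.le
      have hpos : 0 < 1 + y := by linarith [hy.1]
      have hφy : φ (H α y) = (1 + y) ^ (m + 2) * (2 * y * J1 y + ((m + 1 : ℕ) + 1) * J α y) := by
        rw [hid, hκdef]
        simp only [hDy]
        field_simp
      -- The factor `m` makes this true also for `m = 0`, where `m - 1` is truncated.
      have hm : (m : ℝ) * (1 + y) ^ (m - 1) * (1 + y) = m * (1 + y) ^ m := by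
        cases m with
        | zero => simp
        | succ k => simp [pow_succ, mul_assoc]
      beta_reduce
      rw [hφy, hD1, hDy]
      push_cast
      linear_combination (-2 * y * (1 + y) * J α y) * hm

/-- The energy of a solution decreases on `[0, 1]`, hence the solution stays below its initial
value. -/
theorem le_initial_of_truncated_equation (m : ℕ) {L α : ℝ} (hα : 0 < α) {H H1 H2 : ℝ → ℝ}
    (h0 : H 0 = α)
    (hH : ∀ y ∈ Ioo (-1 / 2 : ℝ) 2, HasDerivAt H (H1 y) y ∧ HasDerivAt H1 (H2 y) y ∧
        y * (1 + y) ^ 2 * H2 y + (1 + y) ^ 2 * H1 y + m / 2 * (1 - y ^ 2) * H1 y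
          + liouvilleTrunc m L (H y) = 0) :
    ∀ y ∈ Icc (0 : ℝ) 1, H y ≤ α := by
  set φ := liouvilleTrunc m L
  have hφc : Continuous φ := (contDiff_liouvilleTrunc m L).continuous
  set Φ : ℝ → ℝ := fun v => ∫ x in (0 : ℝ)..v, φ x with hΦdef
  have hΦd : ∀ v, HasDerivAt Φ (φ v) v := fun v =>
    intervalIntegral.integral_hasDerivAt_right (hφc.intervalIntegrable _ _)
      (hφc.stronglyMeasurableAtFilter _ _) hφc.continuousAt
  have hΦm : StrictMonoOn Φ (Ici 0) := by
    refine strictMonoOn_of_deriv_pos (convex_Ici 0)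
      (fun v _ => (hΦd v).continuousAt.continuousWithinAt) fun v hv => ?_
    rw [interior_Ici] at hv
    rw [(hΦd v).deriv]
    exact liouvilleTrunc_pos m L hv
  -- Obtained by multiplying the equation by `H1`. The kinetic term carries the factor `y`, so `E 0
  -- = Φ α`.
  set E : ℝ → ℝ := fun y => y * (1 + y) ^ 2 * H1 y ^ 2 / 2 + Φ (H y) with hEdef
  have hEd : ∀ y ∈ Icc (0 : ℝ) 1, HasDerivAt E
      (-((m + 1) / 2 * (1 + y) * (1 - y) * H1 y ^ 2)) y := by
    intro y hy
    obtain ⟨h1, h2, h3⟩ := hH y ⟨by linarith [hy.1], by linarith [hy.2]⟩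
    have e1 : HasDerivAt (fun y : ℝ => y * (1 + y) ^ 2) ((1 + y) ^ 2 + 2 * y * (1 + y)) y := by
      refine ((hasDerivAt_id y).mul (((hasDerivAt_id y).const_add 1).pow 2)).congr_deriv ?_
      simp
      ring
    have e2 := (e1.mul (h2.pow 2)).div_const 2
    have e3 := e2.add ((hΦd (H y)).comp y h1)
    refine e3.congr_deriv ?_
    simp
    linear_combination H1 y * h3
  have hanti : AntitoneOn E (Icc 0 1) := by
    refine antitoneOn_of_deriv_nonpos (convex_Icc 0 1)
      (fun y hy => (hEd y hy).continuousAt.continuousWithinAt)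
      (fun y hy => ((hEd y (interior_subset hy)).differentiableAt).differentiableWithinAt)
      fun y hy => ?_
    have hy' := interior_subset hy
    rw [(hEd y hy').deriv]
    have h1 : 0 ≤ 1 + y := by linarith [hy'.1]
    have h2 : 0 ≤ 1 - y := by linarith [hy'.2]
    have : 0 ≤ ((m : ℝ) + 1) / 2 * (1 + y) * (1 - y) * H1 y ^ 2 := by positivity
    linarith
  intro y hy
  by_contra! hlt
  have h1 := hanti (left_mem_Icc.2 zero_le_one) hy hy.1
  have h2 : Φ α < Φ (H y) := hΦm hα.le (hα.le.trans hlt.le) hlt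
  have h3 : 0 ≤ y * (1 + y) ^ 2 * H1 y ^ 2 / 2 := by
    have := hy.1
    positivity
  simp only [hEdef, h0] at h1
  linarith

/-- The regular solutions of the Liouville type equation in the stereographic variable. -/
theorem exists_liouville_family (m : ℕ) {L : ℝ} (hL : 0 < L) :
    ∃ H H1 : ℝ → ℝ → ℝ, Continuous (Function.uncurry H) ∧ Continuous (Function.uncurry H1) ∧
      (∀ α, H α 0 = α) ∧
      ∀ α ∈ Ioc 0 L, (∀ y ∈ Icc (0 : ℝ) 1, H α y ≤ α) ∧
        (∀ y ∈ Icc (0 : ℝ) 1, |H1 α y| ≤ 2 ^ (m + 2) * (m + 1) * Real.exp α) ∧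
        ∃ H2 : ℝ → ℝ, Continuous H2 ∧
          (∀ y ∈ Ioo (-1 / 2 : ℝ) 2, HasDerivAt (H α) (H1 α y) y ∧ HasDerivAt (H1 α) (H2 y) y) ∧
          ∀ y ∈ Icc (0 : ℝ) 1,
            y * (1 + y) ^ 2 * H2 y + (1 + y) ^ 2 * H1 α y + m / 2 * (1 - y ^ 2) * H1 α y
              + 2 * (m + 1) * (Real.exp (H α y) - 1) = 0 := by
  obtain ⟨H, H1, hHc, hH1c, hH0, hb, hH⟩ := exists_truncated_family m L
  refine ⟨H, H1, hHc, hH1c, hH0, fun α hα => ?_⟩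
  obtain ⟨H2, hH2c, hH2⟩ := hH α
  -- Since `H ≤ α ≤ L`, the truncated nonlinearity agrees with the original one along the solution.
  have hle := le_initial_of_truncated_equation m hα.1 (hH0 α) hH2
  have hφ : ∀ y ∈ Icc (0 : ℝ) 1, liouvilleTrunc m L (H α y) =
      2 * ((m : ℝ) + 1) * (Real.exp (H α y) - 1) := fun y hy =>
    liouvilleTrunc_of_le m hL.le ((hle y hy).trans hα.2)
  refine ⟨hle, fun y hy => ?_, H2, hH2c, fun y hy => ⟨(hH2 y hy).1, (hH2 y hy).2.1⟩,
    fun y hy => ?_⟩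
  · refine (hb α (2 * ((m : ℝ) + 1) * Real.exp α) (fun y hy => ?_) y hy).trans (le_of_eq ?_)
    · rw [hφ y hy, abs_mul, abs_of_pos (by positivity)]
      gcongr
      have h1 := Real.exp_le_exp.2 (hle y hy)
      have h2 := Real.exp_pos (H α y)
      have h3 := Real.one_le_exp hα.1.le
      rw [abs_le]
      constructor <;> linarith
    · ring
  · rw [← hφ y hy]
    exact (hH2 y ⟨by linarith [hy.1], by linarith [hy.2]⟩).2.2

/-! ### The Emden equation: energy and its decay. -/

/-- The cosine of the polar angle in the variable `t = log (tan (θ / 2))`. -/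
noncomputable def emdenDamping (t : ℝ) : ℝ := (1 - Real.exp (2 * t)) / (1 + Real.exp (2 * t))

theorem continuous_emdenDamping : Continuous emdenDamping := by
  unfold emdenDamping
  exact Continuous.div (by fun_prop) (by fun_prop) fun t => by positivity

theorem emdenDamping_nonneg {t : ℝ} (ht : t ≤ 0) : 0 ≤ emdenDamping t := by
  have : Real.exp (2 * t) ≤ 1 := Real.exp_le_one_iff.2 (by linarith)
  exact div_nonneg (by linarith) (by positivity)

theorem emdenDamping_le_one (t : ℝ) : emdenDamping t ≤ 1 := by
  have := Real.exp_pos (2 * t)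
  rw [emdenDamping, div_le_one (by positivity)]
  linarith

theorem half_le_emdenDamping {t : ℝ} (ht : t ≤ -1) : 1 / 2 ≤ emdenDamping t := by
  have h1 : Real.exp (2 * t) ≤ 1 / 3 := by
    have h2 : Real.exp (2 * t) * Real.exp (-(2 * t)) = 1 := by rw [← Real.exp_add]; simp
    have h3 := Real.add_one_le_exp (-(2 * t))
    nlinarith [Real.exp_pos (2 * t)]
  have := Real.exp_pos (2 * t)
  rw [emdenDamping, le_div_iff₀ (by positivity)]
  linarith

/-- `w` and `p = w'` solve `w'' + m c w' + 2 m (eʷ - 1) = 0` on `[a, 0]`, where `c` is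
`emdenDamping`. -/
structure IsEmdenSolution (m a : ℝ) (w p : ℝ → ℝ) : Prop where
  hasDerivAt_fst : ∀ t ∈ Icc a 0, HasDerivAt w (p t) t
  hasDerivAt_snd : ∀ t ∈ Icc a 0,
    HasDerivAt p (-(m * emdenDamping t * p t) - 2 * m * (Real.exp (w t) - 1)) t

/-- The energy of the equation without damping. -/
noncomputable def emdenEnergy (m w p : ℝ) : ℝ := p ^ 2 / 2 + 2 * m * (Real.exp w - 1 - w)

theorem exp_sub_one_sub_nonneg (x : ℝ) : 0 ≤ Real.exp x - 1 - x := by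
  linarith [Real.add_one_le_exp x]

theorem exp_sub_one_sub_le_mul (x : ℝ) : Real.exp x - 1 - x ≤ (Real.exp x - 1) * x := by
  have h1 := Real.add_one_le_exp (-x)
  have h2 : Real.exp x * Real.exp (-x) = 1 := by rw [← Real.exp_add]; simp
  nlinarith [Real.exp_pos x]

theorem exp_sub_one_mul_nonneg (x : ℝ) : 0 ≤ (Real.exp x - 1) * x :=
  (exp_sub_one_sub_nonneg x).trans (exp_sub_one_sub_le_mul x)

/-- Near a bounded set the restoring force is comparable to a linear one; this absorbs the cross
terms `w p`. -/
theorem exp_neg_mul_sq_le {x R : ℝ} (hx : |x| ≤ R) :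
    Real.exp (-R) * x ^ 2 ≤ (Real.exp x - 1) * x := by
  have hR : 0 ≤ R := (abs_nonneg x).trans hx
  rcases le_total 0 x with h | h
  · have h1 : Real.exp (-R) ≤ 1 := Real.exp_le_one_iff.2 (by linarith)
    have h2 := Real.add_one_le_exp x
    nlinarith [sq_nonneg x]
  · have h1 : Real.exp (-R) ≤ Real.exp x := Real.exp_le_exp.2 (by linarith [(abs_le.1 hx).1])
    have h2 := exp_sub_one_sub_le_mul x
    have h3 := Real.add_one_le_exp (-x)
    have h4 : Real.exp x * Real.exp (-x) = 1 := by rw [← Real.exp_add]; simp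
    have h5 : -x * Real.exp x ≤ 1 - Real.exp x := by nlinarith [Real.exp_pos x]
    nlinarith [sq_nonneg x]

theorem exp_sub_one_mul_le {x R : ℝ} (hx : |x| ≤ R) :
    (Real.exp x - 1) * x ≤ Real.exp R * x ^ 2 := by
  have hR : 0 ≤ R := (abs_nonneg x).trans hx
  rcases le_total 0 x with h | h
  · have h1 : Real.exp x ≤ Real.exp R := Real.exp_le_exp.2 (by linarith [(abs_le.1 hx).2])
    have h3 := Real.add_one_le_exp (-x)
    have h4 : Real.exp x * Real.exp (-x) = 1 := by rw [← Real.exp_add]; simp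
    have h5 : Real.exp x - 1 ≤ x * Real.exp x := by nlinarith [Real.exp_pos x]
    nlinarith [sq_nonneg x]
  · have h1 : 1 ≤ Real.exp R := Real.one_le_exp hR
    have h2 := Real.add_one_le_exp x
    nlinarith [sq_nonneg x]

theorem emdenEnergy_nonneg {m : ℝ} (hm : 0 ≤ m) (w p : ℝ) : 0 ≤ emdenEnergy m w p := by
  have := exp_sub_one_sub_nonneg w
  unfold emdenEnergy
  positivity

theorem sq_le_of_emdenEnergy_le {m w p E₀ : ℝ} (hm : 0 ≤ m) (h : emdenEnergy m w p ≤ E₀) :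
    p ^ 2 ≤ 2 * E₀ := by
  have h1 := mul_nonneg hm (exp_sub_one_sub_nonneg w)
  unfold emdenEnergy at h
  linarith

/-- The potential `exp w - 1 - w` is at least `w² / 2` for `w ≥ 0`, and at least `-w - 1` for `w ≤
0`. -/
theorem abs_le_of_emdenEnergy_le {m w p E₀ : ℝ} (hm : 1 ≤ m) (h : emdenEnergy m w p ≤ E₀) :
    |w| ≤ 1 + E₀ := by
  have h0 := exp_sub_one_sub_nonneg w
  have h1 : Real.exp w - 1 - w ≤ E₀ / 2 := by
    unfold emdenEnergy at h
    nlinarith [sq_nonneg p]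
  rcases le_total 0 w with hw | hw
  · rw [abs_of_nonneg hw]
    have := Real.quadratic_le_exp_of_nonneg hw
    nlinarith
  · rw [abs_of_nonpos hw]
    linarith [Real.exp_pos w]

namespace IsEmdenSolution

variable {m a : ℝ} {w p : ℝ → ℝ}

theorem hasDerivAt_energy (h : IsEmdenSolution m a w p) {t : ℝ} (ht : t ∈ Icc a 0) :
    HasDerivAt (fun t => emdenEnergy m (w t) (p t)) (-(m * emdenDamping t * p t ^ 2)) t := by
  have h1 := h.1 t ht
  have h2 := h.2 t ht
  have h3 := ((h2.pow 2).div_const 2).add ((((h1.exp).sub_const 1).sub h1).const_mul (2 * m))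
  refine h3.congr_deriv ?_
  simp
  ring

theorem antitoneOn_energy (h : IsEmdenSolution m a w p) (hm : 0 ≤ m) :
    AntitoneOn (fun t => emdenEnergy m (w t) (p t)) (Icc a 0) := by
  refine antitoneOn_of_deriv_nonpos (convex_Icc a 0)
    (fun t ht => (h.hasDerivAt_energy ht).continuousAt.continuousWithinAt)
    (fun t ht => (h.hasDerivAt_energy (interior_subset ht)).differentiableAt.differentiableWithinAt)
    fun t ht => ?_
  rw [(h.hasDerivAt_energy (interior_subset ht)).deriv]
  have := emdenDamping_nonneg (interior_subset ht).2
  have : 0 ≤ m * emdenDamping t * p t ^ 2 := by positivity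
  linarith

/-- Because the damping coefficient is at most `m`, the energy decays no faster than `exp (-2 m t)`.
Hence the orbit never reaches the origin and its angle stays defined; no uniqueness theorem for the
equation is needed. -/
theorem energy_pos (h : IsEmdenSolution m a w p) (hm : 0 < m) (ha : w a ≠ 0) :
    ∀ t ∈ Icc a 0, 0 < emdenEnergy m (w t) (p t) := by
  have hd : ∀ t ∈ Icc a 0, HasDerivAt
      (fun t => emdenEnergy m (w t) (p t) * Real.exp (2 * m * t))
      (Real.exp (2 * m * t) * (m * (1 - emdenDamping t) * p t ^ 2 +
        4 * m ^ 2 * (Real.exp (w t) - 1 - w t))) t := by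
    intro t ht
    have h1 : HasDerivAt (fun t : ℝ => Real.exp (2 * m * t)) (Real.exp (2 * m * t) * (2 * m)) t := by
      simpa using ((hasDerivAt_id t).const_mul (2 * m)).exp
    refine ((h.hasDerivAt_energy ht).mul h1).congr_deriv ?_
    unfold emdenEnergy
    ring
  have hmono : MonotoneOn (fun t => emdenEnergy m (w t) (p t) * Real.exp (2 * m * t))
      (Icc a 0) := by
    refine monotoneOn_of_deriv_nonneg (convex_Icc a 0)
      (fun t ht => (hd t ht).continuousAt.continuousWithinAt)
      (fun t ht => (hd t (interior_subset ht)).differentiableAt.differentiableWithinAt)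
      fun t ht => ?_
    rw [(hd t (interior_subset ht)).deriv]
    have h1 := emdenDamping_le_one t
    have h2 := exp_sub_one_sub_nonneg (w t)
    have h3 : 0 ≤ 1 - emdenDamping t := by linarith
    positivity
  intro t ht
  have h1 := hmono ⟨le_rfl, ht.1.trans ht.2⟩ ht ht.1
  have h2 : 0 < emdenEnergy m (w a) (p a) := by
    have : 0 < Real.exp (w a) - 1 - w a := by linarith [Real.add_one_lt_exp ha]
    unfold emdenEnergy
    positivity
  have h3 : 0 < emdenEnergy m (w a) (p a) * Real.exp (2 * m * a) := by positivity
  exact pos_of_mul_pos_left (h3.trans_le h1) (Real.exp_pos _).le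

theorem sq_add_sq_pos (h : IsEmdenSolution m a w p) (hm : 0 < m) (ha : w a ≠ 0) {t : ℝ}
    (ht : t ∈ Icc a 0) : 0 < w t ^ 2 + p t ^ 2 := by
  have h1 := h.energy_pos hm ha t ht
  by_contra! h2
  have hw : w t = 0 := by nlinarith [sq_nonneg (w t), sq_nonneg (p t)]
  have hp : p t = 0 := by nlinarith [sq_nonneg (w t), sq_nonneg (p t)]
  simp [emdenEnergy, hw, hp] at h1

end IsEmdenSolution

/-- The damping makes the energy small after a time which depends only on the initial energy. -/
theorem exists_time_emdenEnergy_le {m : ℝ} (hm : 1 ≤ m) (E₀ : ℝ) {δ : ℝ} (hδ : 0 < δ) :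
    ∃ T > 0, ∀ (a : ℝ) (w p : ℝ → ℝ), IsEmdenSolution m a w p → a + T ≤ -1 →
      emdenEnergy m (w a) (p a) ≤ E₀ →
      ∀ t ∈ Icc (a + T) 0, emdenEnergy m (w t) (p t) ≤ δ := by
  have hm0 : 0 < m := by linarith
  set R := 1 + |E₀|
  set C := R ^ 2 / 2 + |E₀|
  -- Large enough that the dissipation `M m c p²`, with `c ≥ 1 / 2`, dominates both `p²` and the
  -- cross term `m c w p`.
  set M := (3 + m * Real.exp R) / m with hM
  have hMm : M * m = 3 + m * Real.exp R := by rw [hM]; field_simp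
  have hM0 : 0 < M := by positivity
  refine ⟨(M * |E₀| + 2 * C) * 2 / δ + 1, by positivity, fun a w p h haT hE t ht => ?_⟩
  set T := (M * |E₀| + 2 * C) * 2 / δ + 1 with hT
  have hT0 : 0 < T := by positivity
  have hanti := h.antitoneOn_energy hm0.le
  have hIcc : ∀ s ∈ Icc a (a + T), s ∈ Icc a 0 := fun s hs => ⟨hs.1, by linarith [hs.2]⟩
  have hEs : ∀ s ∈ Icc a 0, emdenEnergy m (w s) (p s) ≤ |E₀| := fun s hs =>
    ((hanti ⟨le_rfl, hs.1.trans hs.2⟩ hs hs.1).trans hE).trans (le_abs_self _)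
  set e := emdenEnergy m (w (a + T)) (p (a + T))
  have haT' : a + T ∈ Icc a 0 := hIcc _ ⟨by linarith, le_rfl⟩
  suffices he : e ≤ δ from
    (hanti haT' ⟨by linarith [ht.1], ht.2⟩ ht.1).trans he
  -- The energy alone does not dissipate where `p = 0`. The term `w p` adds the missing decay in
  -- `w`, so that `G' ≤ -e / 2` on `[a, a + T]`, with `e` the energy at the end. As `G` is bounded
  -- there, a long interval forces `e` to be small.
  let G : ℝ → ℝ := fun s => M * emdenEnergy m (w s) (p s) + w s * p s
  have hGd : ∀ s ∈ Icc a 0, HasDerivAt (fun s => G s + e / 2 * s)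
      (M * (-(m * emdenDamping s * p s ^ 2)) + (p s * p s + w s *
        (-(m * emdenDamping s * p s) - 2 * m * (Real.exp (w s) - 1))) + e / 2) s := by
    intro s hs
    have h1 : HasDerivAt (fun s : ℝ => e / 2 * s) (e / 2) s := by
      simpa using (hasDerivAt_id s).const_mul (e / 2)
    exact (((h.hasDerivAt_energy hs).const_mul M).add ((h.1 s hs).mul (h.2 s hs))).add h1
  have hGanti : AntitoneOn (fun s => G s + e / 2 * s) (Icc a (a + T)) := by
    refine antitoneOn_of_deriv_nonpos (convex_Icc a _)
      (fun s hs => (hGd s (hIcc s hs)).continuousAt.continuousWithinAt)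
      (fun s hs => (hGd s (hIcc s (interior_subset hs))).differentiableAt.differentiableWithinAt)
      fun s hs => ?_
    have hs' := interior_subset hs
    have hs0 := hIcc s hs'
    rw [(hGd s hs0).deriv]
    have hes : e ≤ emdenEnergy m (w s) (p s) := hanti hs0 haT' hs'.2
    have hwR := abs_le_of_emdenEnergy_le hm (hEs s hs0)
    have k1 := exp_neg_mul_sq_le hwR
    have k2 := exp_sub_one_sub_le_mul (w s)
    have k3 := half_le_emdenDamping (t := s) (by linarith [hs'.2])
    have k4 := emdenDamping_le_one s
    have k5 : Real.exp R * Real.exp (-R) = 1 := by rw [← Real.exp_add]; simp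
    set c := emdenDamping s
    set x := w s
    set q := p s
    have k6 : -(x * q) * c ≤ (Real.exp (-R) * x ^ 2 + Real.exp R * q ^ 2) / 2 := by
      have k7 : |x * q| ≤ (Real.exp (-R) * x ^ 2 + Real.exp R * q ^ 2) / 2 := by
        have k8 : 0 ≤ (Real.exp (-R)) * (x + Real.exp R * q) ^ 2 := by positivity
        have k9 : 0 ≤ (Real.exp (-R)) * (x - Real.exp R * q) ^ 2 := by positivity
        have k10 : Real.exp (-R) * Real.exp R ^ 2 = Real.exp R := by
          rw [pow_two, ← mul_assoc, mul_comm (Real.exp (-R)), k5, one_mul]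
        rw [abs_le]
        constructor
        · linear_combination k8 / 2 + x * q * k5 + q ^ 2 / 2 * k10
        · linear_combination k9 / 2 - x * q * k5 + q ^ 2 / 2 * k10
      calc -(x * q) * c ≤ |x * q| * 1 := by
            refine mul_le_mul (neg_le_abs _) k4 (by linarith) (abs_nonneg _)
        _ ≤ _ := by linarith
    have k11 : (3 + m * Real.exp R) * q ^ 2 / 2 ≤ M * m * c * q ^ 2 := by
      rw [hMm]
      have : 0 ≤ (3 + m * Real.exp R) * q ^ 2 := by positivity
      nlinarith
    have k12 := mul_le_mul_of_nonneg_left k6 hm0.le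
    have k13 := mul_le_mul_of_nonneg_left k1 hm0.le
    have k14 := mul_le_mul_of_nonneg_left k2 hm0.le
    have k15 := exp_sub_one_sub_nonneg x
    have k16 := mul_nonneg hm0.le k15
    unfold emdenEnergy at hes
    nlinarith [sq_nonneg q]
  have hwp : ∀ s ∈ Icc a 0, |w s * p s| ≤ C := by
    intro s hs
    have h1 := abs_le_of_emdenEnergy_le hm (hEs s hs)
    have h2 := sq_le_of_emdenEnergy_le hm0.le (hEs s hs)
    have h3 : w s ^ 2 ≤ R ^ 2 := sq_le_sq' (by linarith [(abs_le.1 h1).1]) (abs_le.1 h1).2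
    rw [abs_le]
    constructor <;> simp only [C] <;> nlinarith [sq_nonneg (w s + p s), sq_nonneg (w s - p s)]
  have ha0 : a ∈ Icc a 0 := hIcc a ⟨le_rfl, by linarith⟩
  have h1 := hGanti ⟨le_rfl, by linarith⟩ ⟨by linarith, le_rfl⟩ (by linarith : a ≤ a + T)
  have h2 := (abs_le.1 (hwp a ha0)).2
  have h3 := (abs_le.1 (hwp _ haT')).1
  have h4 := mul_le_mul_of_nonneg_left (hEs a ha0) hM0.le
  have h5 : 0 ≤ M * e := mul_nonneg hM0.le (emdenEnergy_nonneg hm0.le _ _)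
  have h6 : e / 2 * T ≤ M * |E₀| + 2 * C := by
    simp only [G] at h1
    change M * e + _ + _ ≤ _ at h1
    linarith
  by_contra! hlt
  have h7 : (T - 1) * δ = (M * |E₀| + 2 * C) * 2 := by rw [hT]; field_simp; ring
  nlinarith

/-! ### Rotation in the phase plane. -/

/-- The angular velocity of `(w, p)` along solutions of the Emden equation. -/
noncomputable def phaseSpeed (m t w p : ℝ) : ℝ :=
  (p ^ 2 + m * emdenDamping t * w * p + 2 * m * ((Real.exp w - 1) * w)) / (w ^ 2 + p ^ 2)

/-- Limits the backward rotation while the energy is not yet small: only the cross term can be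
negative. -/
theorem neg_le_phaseSpeed {m t w p : ℝ} (hm : 0 ≤ m) (ht : t ≤ 0) (h : 0 < w ^ 2 + p ^ 2) :
    -m ≤ phaseSpeed m t w p := by
  rw [phaseSpeed, le_div_iff₀ h]
  have h1 := emdenDamping_nonneg ht
  have h2 := emdenDamping_le_one t
  have h3 := mul_nonneg hm (exp_sub_one_mul_nonneg w)
  have h4 : -(w ^ 2 + p ^ 2) ≤ emdenDamping t * (w * p) := by
    nlinarith [sq_nonneg (w + p), sq_nonneg (w - p), sq_nonneg w, sq_nonneg p]
  nlinarith [mul_le_mul_of_nonneg_left h4 hm, sq_nonneg p]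

/-- Bounds the total angle of the first member of the family from above. -/
theorem phaseSpeed_le {m t w p R : ℝ} (hm : 0 ≤ m) (ht : t ≤ 0) (h : 0 < w ^ 2 + p ^ 2)
    (hw : |w| ≤ R) : phaseSpeed m t w p ≤ 1 + m + 2 * m * Real.exp R := by
  rw [phaseSpeed, div_le_iff₀ h]
  have h1 := emdenDamping_nonneg ht
  have h2 := emdenDamping_le_one t
  have h3 := mul_le_mul_of_nonneg_left (exp_sub_one_mul_le hw) hm
  have h4 : emdenDamping t * (w * p) ≤ w ^ 2 + p ^ 2 := by
    nlinarith [sq_nonneg (w + p), sq_nonneg (w - p), sq_nonneg w, sq_nonneg p]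
  have h5 : 0 ≤ m * Real.exp R * p ^ 2 := by positivity
  nlinarith [mul_le_mul_of_nonneg_left h4 hm, sq_nonneg w]

/-- Near the origin the phase rotates with a definite speed. This is where `m < 8` is used. -/
theorem le_phaseSpeed {m t w p : ℝ} (hm : 1 ≤ m) (hm7 : m ≤ 7) (ht : t ≤ 0)
    (h : 0 < w ^ 2 + p ^ 2) (hw : -1 / 16 ≤ w) : 1 / 20 ≤ phaseSpeed m t w p := by
  rw [phaseSpeed, le_div_iff₀ h]
  have h1 := emdenDamping_nonneg ht
  have h2 := emdenDamping_le_one t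
  -- For `w ≤ 0`, `exp w ≤ 1 + w + w² / 2` gives the factor `1 + w / 2`, which is at least `31 / 32`
  -- when `w ≥ -1 / 16`.
  have h3 : 31 / 32 * w ^ 2 ≤ (Real.exp w - 1) * w := by
    rcases le_total 0 w with h0 | h0
    · nlinarith [Real.add_one_le_exp w, sq_nonneg w]
    · have h4 : Real.exp w ≤ 1 + w + w ^ 2 / 2 := by
        have h5 := Real.quadratic_le_exp_of_nonneg (x := -w) (by linarith)
        have h6 : Real.exp w * Real.exp (-w) = 1 := by rw [← Real.exp_add]; simp
        have h7 : 0 ≤ 1 + w + w ^ 2 / 2 := by nlinarith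
        have h8 := mul_le_mul_of_nonneg_left h5 h7
        have h9 : 1 ≤ (1 + w + w ^ 2 / 2) * Real.exp (-w) := by nlinarith [sq_nonneg (w ^ 2)]
        have h10 := mul_le_mul_of_nonneg_left h9 (Real.exp_pos w).le
        nlinarith
      nlinarith [sq_nonneg w]
  have h4 := mul_le_mul_of_nonneg_left h3 (by linarith : 0 ≤ m)
  have h5 : -(m * |w * p|) ≤ m * emdenDamping t * w * p := by
    have : -|w * p| ≤ emdenDamping t * (w * p) := by
      have := neg_abs_le (w * p)
      nlinarith [abs_nonneg (w * p), le_abs_self (w * p)]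
    nlinarith
  -- Completing the square leaves `31/16 m - 1/20 - 5/19 m²`, which is positive for `1 ≤ m ≤ 7`.
  -- Without the losses it would be `2 m - m² / 4`, positive for `m < 8`.
  have h6 : (1 / 20 : ℝ) * (w ^ 2 + p ^ 2) + m * |w * p| ≤ p ^ 2 + 31 / 16 * m * w ^ 2 := by
    rw [abs_mul, ← sq_abs w, ← sq_abs p]
    set x := |w|
    set y := |p|
    have h7 : 0 ≤ (19 / 20) * (y - 10 / 19 * m * x) ^ 2 := by positivity
    have h8 : 0 ≤ (31 / 16 * m - 1 / 20 - 5 / 19 * m ^ 2) * x ^ 2 := by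
      refine mul_nonneg ?_ (sq_nonneg x)
      nlinarith
    nlinarith
  nlinarith

/-- The threshold is the potential at `-1 / 16`, and the potential decreases on `w < 0`; it enters
the energy with the factor `2 m ≥ 2`. -/
theorem neg_lt_of_emdenEnergy_le {m w p : ℝ} (hm : 1 ≤ m)
    (h : emdenEnergy m w p ≤ Real.exp (-1 / 16) - 1 - (-1 / 16)) : -1 / 16 ≤ w := by
  by_contra! hw
  have h0 := exp_sub_one_sub_nonneg w
  have h1 : Real.exp w - 1 - w ≤ (Real.exp (-1 / 16) - 1 - (-1 / 16)) / 2 := by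
    unfold emdenEnergy at h
    nlinarith [sq_nonneg p]
  have h2 : 0 < Real.exp (-1 / 16) - 1 - (-1 / 16) := by
    linarith [Real.add_one_lt_exp (x := -1 / 16) (by norm_num)]
  have h3 := Real.add_one_le_exp (w - -1 / 16)
  have h4 : Real.exp (-1 / 16) * Real.exp (w - -1 / 16) = Real.exp w := by
    rw [← Real.exp_add]; congr 1; ring
  have h5 : Real.exp (-1 / 16) ≤ 1 := Real.exp_le_one_iff.2 (by norm_num)
  nlinarith [Real.exp_pos (-1 / 16)]

namespace IsEmdenSolution

variable {m a : ℝ} {w p : ℝ → ℝ}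

/-- While `w < 0`, the phase is `-arctan (p / w)`. -/
theorem phase_eq_arctan (h : IsEmdenSolution m a w p) {b : ℝ} (hb : b ∈ Icc a 0)
    (hneg : ∀ t ∈ Icc a b, w t < 0) {Q : ℝ → ℝ} (hQ : Continuous Q)
    (hQe : ∀ t ∈ Icc a 0, Q t = phaseSpeed m t (w t) (p t)) :
    -Real.arctan (p a / w a) + ∫ t in a..b, Q t = -Real.arctan (p b / w b) := by
  have hd : ∀ t ∈ uIcc a b, HasDerivAt (fun t => -Real.arctan (p t / w t)) (Q t) t := by
    intro t ht
    rw [uIcc_of_le hb.1] at ht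
    have ht0 : t ∈ Icc a 0 := ⟨ht.1, ht.2.trans hb.2⟩
    have hw := (hneg t ht).ne
    refine ((((h.2 t ht0).div (h.1 t ht0) hw).arctan).neg).congr_deriv ?_
    have hpos : w t ^ 2 + p t ^ 2 ≠ 0 := by positivity
    rw [hQe t ht0, phaseSpeed]
    simp only [Pi.div_apply]
    field_simp
    ring
  rw [intervalIntegral.integral_eq_sub_of_hasDerivAt hd (hQ.intervalIntegrable _ _)]
  ring

/-- If the phase at time `0` is a multiple of `π`, then `p` vanishes there. -/
theorem snd_eq_zero_of_phase (h : IsEmdenSolution m a w p) (hm : 0 < m) (ha : a ≤ 0)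
    (hneg : w a < 0) {Q : ℝ → ℝ} (hQ : Continuous Q)
    (hQe : ∀ t ∈ Icc a 0, Q t = phaseSpeed m t (w t) (p t)) {k : ℤ}
    (hk : -Real.arctan (p a / w a) + ∫ t in a..0, Q t = k * Real.pi) : p 0 = 0 := by
  set φ : ℝ → ℝ := fun t => -Real.arctan (p a / w a) + ∫ s in a..t, Q s with hφ
  have hφd : ∀ t, HasDerivAt φ (Q t) t := fun t =>
    (intervalIntegral.integral_hasDerivAt_right (hQ.intervalIntegrable _ _)
      (hQ.stronglyMeasurableAtFilter _ _) hQ.continuousAt).const_add _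
  have hpos : ∀ t ∈ Icc a 0, 0 < w t ^ 2 + p t ^ 2 := fun t ht => h.sq_add_sq_pos hm hneg.ne ht
  -- If `(w, p) = ρ (cos ψ, -sin ψ)`, this is `sin² (φ - ψ)`. Its constancy shows that `φ` follows
  -- the true angle modulo `π`, with no continuous lift of `ψ`.
  set F : ℝ → ℝ := fun t =>
    (w t * Real.sin (φ t) + p t * Real.cos (φ t)) ^ 2 / (w t ^ 2 + p t ^ 2) with hF
  have hFd : ∀ t ∈ Icc a 0, HasDerivAt F 0 t := by
    intro t ht
    have h1 := h.1 t ht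
    have h2 := h.2 t ht
    have h3 := hφd t
    have hρ := (hpos t ht).ne'
    have hu := (h1.mul h3.sin).add (h2.mul h3.cos)
    refine ((hu.pow 2).div ((h1.pow 2).add (h2.pow 2)) hρ).congr_deriv ?_
    have hq : Q t * (w t ^ 2 + p t ^ 2) = p t ^ 2 + m * emdenDamping t * w t * p t
        + 2 * m * ((Real.exp (w t) - 1) * w t) := by
      rw [hQe t ht, phaseSpeed]; field_simp
    have hsc := Real.sin_sq_add_cos_sq (φ t)
    simp only [Pi.add_apply, Pi.mul_apply, Pi.pow_apply]
    rw [div_eq_zero_iff]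
    left
    set s := Real.sin (φ t)
    set c := Real.cos (φ t)
    set x := w t
    set y := p t
    set y' := -(m * emdenDamping t * y) - 2 * m * (Real.exp x - 1) with hy'
    have hq' : Q t * (x ^ 2 + y ^ 2) = y ^ 2 - x * y' := by rw [hq, hy']; ring
    push_cast
    linear_combination (2 * (x * s + y * c) * (x * c - y * s)) * hq'
  have hconst := constant_of_has_deriv_right_zero (f := F) (a := a) (b := 0)
    (fun t ht => (hFd t ht).continuousAt.continuousWithinAt)
    (fun t ht => (hFd t ⟨ht.1, ht.2.le⟩).hasDerivWithinAt) 0 ⟨ha, le_rfl⟩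
  have hFa : F a = 0 := by
    have h1 : φ a = -Real.arctan (p a / w a) := by simp [hφ]
    have h2 : w a * Real.sin (φ a) + p a * Real.cos (φ a) = 0 := by
      have h3 := Real.tan_arctan (p a / w a)
      have h4 := Real.cos_arctan_pos (p a / w a)
      rw [Real.tan_eq_sin_div_cos, div_eq_div_iff h4.ne' hneg.ne] at h3
      rw [h1, Real.sin_neg, Real.cos_neg]
      linarith
    simp [hF, h2]
  rw [hFa] at hconst
  have h5 : w 0 * Real.sin (φ 0) + p 0 * Real.cos (φ 0) = 0 := by
    have := (div_eq_zero_iff.1 hconst).resolve_right (hpos 0 ⟨ha, le_rfl⟩).ne'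
    exact pow_eq_zero_iff two_ne_zero |>.1 this
  have h6 : φ 0 = k * Real.pi := hk
  rw [h6, Real.sin_int_mul_pi, mul_zero, zero_add] at h5
  refine (mul_eq_zero.1 h5).resolve_right fun hc => ?_
  have := Real.sin_sq_add_cos_sq (k * Real.pi)
  rw [hc, Real.sin_int_mul_pi] at this
  norm_num at this

end IsEmdenSolution

/-- A continuous family of solutions which start with `w < 0` at the times `-α / 2 - 2` with
bounded energy rotates arbitrarily often as `α → ∞`; in particular `p` vanishes at time `0` for
some members of the family. -/
theorem exists_emden_family_snd_eq_zero {m : ℝ} (hm : 1 ≤ m) (hm7 : m ≤ 7) (E₀ : ℝ) {A : ℝ}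
    (hA : 0 ≤ A) :
    ∃ B > A, ∀ w p : ℝ → ℝ → ℝ, Continuous (Function.uncurry w) →
      Continuous (Function.uncurry p) →
      (∀ α ∈ Icc A B, IsEmdenSolution m (-B / 2 - 2) (w α) (p α)) →
      (∀ α ∈ Icc A B, ∀ t ∈ Icc (-B / 2 - 2) (-α / 2 - 2), w α t < 0) →
      (∀ α ∈ Icc A B, emdenEnergy m (w α (-α / 2 - 2)) (p α (-α / 2 - 2)) ≤ E₀) →
      ∃ α ∈ Icc A B, p α 0 = 0 := by
  have hm0 : 0 < m := by linarith
  have hδ : 0 < Real.exp (-1 / 16) - 1 - (-1 / 16) := by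
    linarith [Real.add_one_lt_exp (x := -1 / 16) (by norm_num)]
  obtain ⟨T, hT0, hT⟩ := exists_time_emdenEnergy_le hm E₀ hδ
  have hpi := Real.pi_pos
  -- A bound for the final angle of the member `A`: `π / 2` as long as `w < 0`, then maximal speed
  -- for the time `A / 2 + 2`. It must not involve `B`, which is chosen from it.
  set U := Real.pi / 2 + (A / 2 + 2) * (1 + m + 2 * m * Real.exp (1 + E₀)) with hU
  -- Makes `(B / 2 + 2 - T) / 20 - m T - π / 2`, a lower bound for the final angle of the member
  -- `B`, at least `U + π`.
  set B := A + 2 * T + |40 * (U + 2 * Real.pi + m * T)| + 1 with hB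
  have hAB : A < B := by
    have := abs_nonneg (40 * (U + 2 * Real.pi + m * T))
    linarith
  refine ⟨B, hAB, fun w p hw hp hsol hneg hE => ?_⟩
  set s := -B / 2 - 2 with hs
  have hs0 : s ≤ 0 := by linarith
  -- Clamping `α` and `t` to the rectangle where the orbit avoids the origin makes the angular speed
  -- continuous on the whole plane.
  let cα : ℝ → ℝ := fun α => max A (min α B)
  let ct : ℝ → ℝ := fun t => max s (min t 0)
  have hcα : ∀ α, cα α ∈ Icc A B := fun α => ⟨le_max_left _ _, max_le hAB.le (min_le_right _ _)⟩
  have hct : ∀ t, ct t ∈ Icc s 0 := fun t => ⟨le_max_left _ _, max_le hs0 (min_le_right _ _)⟩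
  have hcα' : ∀ α ∈ Icc A B, cα α = α := fun α hα => by
    simp only [cα, min_eq_left hα.2, max_eq_right hα.1]
  have hct' : ∀ t ∈ Icc s 0, ct t = t := fun t ht => by
    simp only [ct, min_eq_left ht.2, max_eq_right ht.1]
  have hsA : ∀ α ∈ Icc A B, s ∈ Icc s (-α / 2 - 2) := fun α hα => ⟨le_rfl, by linarith [hα.2]⟩
  have hnegs : ∀ α ∈ Icc A B, w α s < 0 := fun α hα => hneg α hα s (hsA α hα)
  have hpos : ∀ α ∈ Icc A B, ∀ t ∈ Icc s 0, 0 < w α t ^ 2 + p α t ^ 2 := fun α hα t ht =>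
    (hsol α hα).sq_add_sq_pos hm0 (hnegs α hα).ne ht
  let Q : ℝ → ℝ → ℝ := fun α t => phaseSpeed m (ct t) (w (cα α) (ct t)) (p (cα α) (ct t))
  have hw' : Continuous fun q : ℝ × ℝ => w (cα q.1) (ct q.2) :=
    hw.comp (f := fun q : ℝ × ℝ => (cα q.1, ct q.2)) (by fun_prop)
  have hp' : Continuous fun q : ℝ × ℝ => p (cα q.1) (ct q.2) :=
    hp.comp (f := fun q : ℝ × ℝ => (cα q.1, ct q.2)) (by fun_prop)
  have hQ : Continuous (Function.uncurry Q) := by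
    have hc : Continuous fun q : ℝ × ℝ => emdenDamping (ct q.2) :=
      continuous_emdenDamping.comp (by fun_prop)
    refine Continuous.div (by fun_prop) (by fun_prop) fun q => ?_
    exact (hpos _ (hcα q.1) _ (hct q.2)).ne'
  have hQα : ∀ α, Continuous (Q α) := fun α => hQ.comp (f := fun t => (α, t)) (by fun_prop)
  have hQe : ∀ α ∈ Icc A B, ∀ t ∈ Icc s 0, Q α t = phaseSpeed m t (w α t) (p α t) :=
    fun α hα t ht => by simp only [Q, hcα' α hα, hct' t ht]
  -- All angles are measured from the common time `s`, where every member has `w < 0`, so the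
  -- arctangent is continuous in `α`.
  let Φ : ℝ → ℝ := fun α => -Real.arctan (p α s / w α s) + ∫ t in s..0, Q α t
  have hΦ : ContinuousOn Φ (Icc A B) := by
    have h1 : Continuous fun α => ∫ t in s..0, Q α t :=
      intervalIntegral.continuous_parametric_intervalIntegral_of_continuous' hQ _ _
    have h2 : Continuous fun α => w α s := hw.comp (f := fun α => (α, s)) (by fun_prop)
    have h3 : Continuous fun α => p α s := hp.comp (f := fun α => (α, s)) (by fun_prop)
    have h4 : ContinuousOn (fun α => p α s / w α s) (Icc A B) :=
      h3.continuousOn.div h2.continuousOn fun α hα => (hnegs α hα).ne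
    exact (Real.continuous_arctan.comp_continuousOn h4).neg.add h1.continuousOn
  have hAm : A ∈ Icc A B := ⟨le_rfl, hAB.le⟩
  have hBm : B ∈ Icc A B := ⟨hAB.le, le_rfl⟩
  have hΦA : Φ A ≤ U := by
    set sA := -A / 2 - 2 with hsA'
    have hsA0 : sA ∈ Icc s 0 := ⟨by linarith, by linarith⟩
    -- The orbit stays in `w < 0` until `sA`, so its angle there is again an arctangent, however
    -- long `[s, sA]` is.
    have h1 := (hsol A hAm).phase_eq_arctan hsA0 (hneg A hAm) (hQα A) (hQe A hAm)
    have h2 : Φ A = -Real.arctan (p A sA / w A sA) + ∫ t in sA..0, Q A t := by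
      rw [← h1, add_assoc, intervalIntegral.integral_add_adjacent_intervals
        ((hQα A).intervalIntegrable _ _) ((hQα A).intervalIntegrable _ _)]
    have h3 : ∫ t in sA..0, Q A t ≤ ∫ t in sA..0, (1 + m + 2 * m * Real.exp (1 + E₀)) := by
      refine intervalIntegral.integral_mono_on hsA0.2 ((hQα A).intervalIntegrable _ _)
        (continuous_const.intervalIntegrable _ _) fun t ht => ?_
      have ht' : t ∈ Icc s 0 := ⟨hsA0.1.trans ht.1, ht.2⟩
      rw [hQe A hAm t ht']
      refine phaseSpeed_le hm0.le ht.2 (hpos A hAm t ht') (abs_le_of_emdenEnergy_le hm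
        (le_trans ?_ (hE A hAm)) (p := p A t))
      exact (hsol A hAm).antitoneOn_energy hm0.le hsA0 ht' ht.1
    rw [intervalIntegral.integral_const, smul_eq_mul] at h3
    have h4 := Real.neg_pi_div_two_lt_arctan (p A sA / w A sA)
    have h5 : 0 - sA = A / 2 + 2 := by rw [hsA']; ring
    rw [h5] at h3
    rw [h2, hU]
    linarith
  have hΦB : U + Real.pi ≤ Φ B := by
    have hsT : s + T ≤ -1 := by
      have := abs_nonneg (40 * (U + 2 * Real.pi + m * T))
      linarith
    have hsT' : s + T ∈ Icc s 0 := ⟨by linarith, by linarith⟩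
    have hE' := hT s (w B) (p B) (hsol B hBm) hsT (hE B hBm)
    have h1 : ∫ t in s..(s + T), (-m) ≤ ∫ t in s..(s + T), Q B t := by
      refine intervalIntegral.integral_mono_on hsT'.1 (continuous_const.intervalIntegrable _ _)
        ((hQα B).intervalIntegrable _ _) fun t ht => ?_
      have ht' : t ∈ Icc s 0 := ⟨ht.1, ht.2.trans hsT'.2⟩
      rw [hQe B hBm t ht']
      exact neg_le_phaseSpeed hm0.le ht'.2 (hpos B hBm t ht')
    have h2 : ∫ t in (s + T)..0, (1 / 20 : ℝ) ≤ ∫ t in (s + T)..0, Q B t := by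
      refine intervalIntegral.integral_mono_on hsT'.2 (continuous_const.intervalIntegrable _ _)
        ((hQα B).intervalIntegrable _ _) fun t ht => ?_
      have ht' : t ∈ Icc s 0 := ⟨hsT'.1.trans ht.1, ht.2⟩
      rw [hQe B hBm t ht']
      exact le_phaseSpeed hm hm7 ht.2 (hpos B hBm t ht')
        (neg_lt_of_emdenEnergy_le hm (hE' t ht))
    rw [intervalIntegral.integral_const, smul_eq_mul] at h1 h2
    have h3 : (∫ t in s..(s + T), Q B t) + ∫ t in (s + T)..0, Q B t = ∫ t in s..0, Q B t :=
      intervalIntegral.integral_add_adjacent_intervals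
        ((hQα B).intervalIntegrable _ _) ((hQα B).intervalIntegrable _ _)
    have h4 := Real.arctan_lt_pi_div_two (p B s / w B s)
    have h5 := le_abs_self (40 * (U + 2 * Real.pi + m * T))
    simp only [Φ]
    rw [← h3]
    linarith
  have hk1 : Φ A ≤ (⌈Φ A / Real.pi⌉ : ℝ) * Real.pi := by
    rw [← div_le_iff₀ hpi]
    exact Int.le_ceil _
  have hk2 : (⌈Φ A / Real.pi⌉ : ℝ) * Real.pi ≤ Φ B := by
    have h1 := (Int.ceil_lt_add_one (Φ A / Real.pi)).le
    have h2 := mul_le_mul_of_nonneg_right h1 hpi.le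
    rw [add_mul, div_mul_cancel₀ _ hpi.ne'] at h2
    linarith
  obtain ⟨α, hα, hαk⟩ := intermediate_value_Icc hAB.le hΦ ⟨hk1, hk2⟩
  exact ⟨α, hα, (hsol α hα).snd_eq_zero_of_phase hm0 hs0 (hnegs α hα) (hQα α) (hQe α hα) hαk⟩

/-! ### From regular profiles to Emden orbits. -/

/-- The difference of a profile and of the singular solution, in the variable `t = log y / 2`. -/
noncomputable def emdenFst (m : ℝ) (H : ℝ → ℝ) (t : ℝ) : ℝ :=
  H (Real.exp (2 * t)) + Real.log ((m + 1) / m) - 2 * Real.log (1 + Real.exp (2 * t))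
    + 2 * Real.log 2 + 2 * t

/-- The derivative of `emdenFst`. -/
noncomputable def emdenSnd (H1 : ℝ → ℝ) (t : ℝ) : ℝ :=
  2 * Real.exp (2 * t) * H1 (Real.exp (2 * t)) + 2 * emdenDamping t

/-- With `y = exp (2 t)`, `exp w` is `exp H` times `(m + 1) / m * 4 y / (1 + y)²`, the last factor
being `sin² θ`. The Emden equation is the profile equation multiplied by `4 y / (1 + y)²`. -/
theorem isEmdenSolution_of_profile {m : ℝ} (hm : 0 < m) {H H1 H2 : ℝ → ℝ}
    (hd : ∀ y ∈ Ioo (-1 / 2 : ℝ) 2, HasDerivAt H (H1 y) y ∧ HasDerivAt H1 (H2 y) y)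
    (heq : ∀ y ∈ Icc (0 : ℝ) 1, y * (1 + y) ^ 2 * H2 y + (1 + y) ^ 2 * H1 y
      + m / 2 * (1 - y ^ 2) * H1 y + 2 * (m + 1) * (Real.exp (H y) - 1) = 0) (a : ℝ) :
    IsEmdenSolution m a (emdenFst m H) (emdenSnd H1) := by
  have hy : ∀ t : ℝ, HasDerivAt (fun t : ℝ => Real.exp (2 * t)) (2 * Real.exp (2 * t)) t := by
    intro t
    have := ((hasDerivAt_id t).const_mul 2).exp
    simp only [id, mul_one] at this
    exact this.congr_deriv (mul_comm _ _)
  have hy1 : ∀ t ∈ Icc a 0, Real.exp (2 * t) ≤ 1 := fun t ht =>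
    Real.exp_le_one_iff.2 (by linarith [ht.2])
  have hym : ∀ t ∈ Icc a 0, Real.exp (2 * t) ∈ Ioo (-1 / 2 : ℝ) 2 := fun t ht =>
    ⟨by linarith [Real.exp_pos (2 * t)], by linarith [hy1 t ht]⟩
  refine ⟨fun t ht => ?_, fun t ht => ?_⟩
  · have hpos := Real.exp_pos (2 * t)
    have h1 := (hd _ (hym t ht)).1.comp t (hy t)
    have h2 := (((hy t).const_add 1).log (by positivity)).const_mul 2
    have h3 := ((((h1.add_const (Real.log ((m + 1) / m))).sub h2).add_const
      (2 * Real.log 2)).add ((hasDerivAt_id t).const_mul 2))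
    refine h3.congr_deriv ?_
    rw [emdenSnd, emdenDamping]
    field_simp
    ring
  · have hpos := Real.exp_pos (2 * t)
    have h1 := (hd _ (hym t ht)).2.comp t (hy t)
    have h2 := ((hy t).const_mul 2).mul h1
    have h3 := (((hy t).const_sub 1).div ((hy t).const_add 1) (by positivity)).const_mul 2
    refine (h2.add h3).congr_deriv ?_
    have e := heq _ ⟨hpos.le, hy1 t ht⟩
    have hw : Real.exp (emdenFst m H t) = Real.exp (H (Real.exp (2 * t))) * ((m + 1) / m) *
        (4 * Real.exp (2 * t)) / (1 + Real.exp (2 * t)) ^ 2 := by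
      have l1 : Real.exp (2 * Real.log 2) = 4 := by
        rw [two_mul, Real.exp_add, Real.exp_log two_pos]; norm_num
      have l2 : Real.exp (2 * Real.log (1 + Real.exp (2 * t))) = (1 + Real.exp (2 * t)) ^ 2 := by
        rw [two_mul, Real.exp_add, Real.exp_log (by positivity)]; ring
      rw [emdenFst, Real.exp_add, Real.exp_add, Real.exp_sub, Real.exp_add,
        Real.exp_log (by positivity), l1, l2]
      ring
    rw [hw, emdenSnd, emdenDamping]
    simp only [Function.comp_apply]
    set y := Real.exp (2 * t)
    have e2 : (4 * y / (1 + y) ^ 2) * (y * (1 + y) ^ 2 * H2 y + (1 + y) ^ 2 * H1 y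
      + m / 2 * (1 - y ^ 2) * H1 y + 2 * (m + 1) * (Real.exp (H y) - 1)) = 0 := by
      rw [e, mul_zero]
    rw [← sub_eq_zero, ← e2]
    field_simp
    ring

/-- The time `-α / 2 - 2` is `y = exp (-α - 4)`, the scale on which `H` has left `α` by at most a
constant. The shift by `2` gives the sign, as `3 log 2 < 4`. -/
theorem emdenFst_bounds {m α C : ℝ} (hm : 1 ≤ m) {H : ℝ → ℝ}
    (hle : ∀ y ∈ Icc (0 : ℝ) 1, H y ≤ α)
    (hge : ∀ y ∈ Icc (0 : ℝ) 1, α - C * Real.exp α * y ≤ H y) (hα : 0 ≤ α) (hC : 0 ≤ C) :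
    (∀ t ≤ -α / 2 - 2, emdenFst m H t < 0) ∧ |emdenFst m H (-α / 2 - 2)| ≤ C + 4 := by
  have hl2 : Real.log 2 < 0.7 := Real.log_two_lt_d9.trans (by norm_num)
  have hl0 : 0 ≤ Real.log ((m + 1) / m) := by
    apply Real.log_nonneg
    rw [le_div_iff₀ (by linarith)]
    linarith
  have hl1 : Real.log ((m + 1) / m) ≤ Real.log 2 := by
    apply Real.log_le_log (by positivity)
    rw [div_le_iff₀ (by linarith)]
    linarith
  have hy : ∀ t ≤ -α / 2 - 2, Real.exp (2 * t) ∈ Icc (0 : ℝ) 1 := fun t ht =>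
    ⟨(Real.exp_pos _).le, Real.exp_le_one_iff.2 (by linarith)⟩
  have hneg : ∀ t ≤ -α / 2 - 2, emdenFst m H t < 0 := by
    intro t ht
    have h1 := hle _ (hy t ht)
    have h2 : 0 ≤ Real.log (1 + Real.exp (2 * t)) :=
      Real.log_nonneg (by linarith [Real.exp_pos (2 * t)])
    unfold emdenFst
    linarith
  refine ⟨hneg, ?_⟩
  have h0 := hneg _ le_rfl
  rw [abs_of_neg h0]
  have h1 := hge _ (hy _ le_rfl)
  have h2 : Real.log (1 + Real.exp (2 * (-α / 2 - 2))) ≤ Real.log 2 :=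
    Real.log_le_log (by positivity) (by linarith [(hy _ le_rfl).2])
  have h3 : Real.exp α * Real.exp (2 * (-α / 2 - 2)) ≤ 1 := by
    rw [← Real.exp_add]
    exact Real.exp_le_one_iff.2 (by linarith)
  have h4 := mul_le_mul_of_nonneg_left h3 hC
  unfold emdenFst
  linarith

theorem abs_emdenSnd_le {α C : ℝ} {H1 : ℝ → ℝ} (hα : 0 ≤ α)
    (hb : ∀ y ∈ Icc (0 : ℝ) 1, |H1 y| ≤ C * Real.exp α) :
    |emdenSnd H1 (-α / 2 - 2)| ≤ 2 * C + 2 := by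
  set t := -α / 2 - 2 with ht
  have hy : Real.exp (2 * t) ∈ Icc (0 : ℝ) 1 :=
    ⟨(Real.exp_pos _).le, Real.exp_le_one_iff.2 (by linarith)⟩
  have hC : 0 ≤ C * Real.exp α := (abs_nonneg _).trans (hb _ hy)
  have hC0 : 0 ≤ C := nonneg_of_mul_nonneg_left hC (Real.exp_pos _)
  have h3 : Real.exp (2 * t) * Real.exp α ≤ 1 := by
    rw [← Real.exp_add]
    exact Real.exp_le_one_iff.2 (by rw [ht]; linarith)
  have h4 : |2 * Real.exp (2 * t) * H1 (Real.exp (2 * t))| ≤ 2 * C := by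
    rw [abs_mul, abs_of_nonneg (by positivity)]
    have := mul_le_mul_of_nonneg_left (hb _ hy) (by positivity : 0 ≤ 2 * Real.exp (2 * t))
    have := mul_le_mul_of_nonneg_left h3 hC0
    linarith
  have h5 : |2 * emdenDamping t| ≤ 2 := by
    have := emdenDamping_le_one t
    have := emdenDamping_nonneg (t := t) (by linarith)
    rw [abs_of_nonneg (by positivity)]
    linarith
  exact (abs_add_le _ _).trans (by linarith)

/-- There are regular profiles with arbitrarily large initial value which are critical at the
equator `y = 1`. -/
theorem exists_critical_profile {m : ℕ} (hm : 1 ≤ m) (hm7 : m ≤ 7) {A : ℝ} (hA : 0 < A) :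
    ∃ α ≥ A, ∃ H H1 H2 : ℝ → ℝ, H 0 = α ∧ H1 1 = 0 ∧ Continuous H2 ∧
      (∀ y ∈ Ioo (-1 / 2 : ℝ) 2, HasDerivAt H (H1 y) y ∧ HasDerivAt H1 (H2 y) y) ∧
      ∀ y ∈ Icc (0 : ℝ) 1, y * (1 + y) ^ 2 * H2 y + (1 + y) ^ 2 * H1 y
        + m / 2 * (1 - y ^ 2) * H1 y + 2 * (m + 1) * (Real.exp (H y) - 1) = 0 := by
  have hm' : (1 : ℝ) ≤ m := by exact_mod_cast hm
  set C : ℝ := 2 ^ (m + 2) * (m + 1)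
  have hC0 : 0 ≤ C := by positivity
  -- The energy bound comes from `|p| ≤ 2 C + 2` and `|w| ≤ C + 4` at the time `-α / 2 - 2`. It is
  -- uniform in `α`, so `B` can be fixed first and then serve as truncation level.
  obtain ⟨B, hAB, hB⟩ := exists_emden_family_snd_eq_zero hm' (by exact_mod_cast hm7)
    ((2 * C + 2) ^ 2 / 2 + 2 * m * (Real.exp (C + 4) + (C + 4))) hA.le
  obtain ⟨H, H1, hHc, hH1c, hH0, hH⟩ := exists_liouville_family m (hA.trans hAB)
  have hIoc : ∀ α ∈ Icc A B, α ∈ Ioc 0 B := fun α hα => ⟨hA.trans_le hα.1, hα.2⟩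
  have hbounds : ∀ α ∈ Icc A B, (∀ t ≤ -α / 2 - 2, emdenFst m (H α) t < 0) ∧
      |emdenFst m (H α) (-α / 2 - 2)| ≤ C + 4 := by
    intro α hα
    obtain ⟨hle, hb, H2, -, hd, -⟩ := hH α (hIoc α hα)
    refine emdenFst_bounds hm' hle (fun y hy => ?_) (hIoc α hα).1.le hC0
    have := (convex_Icc (0 : ℝ) 1).norm_image_sub_le_of_norm_hasDerivWithin_le
      (fun x hx => ((hd x ⟨by linarith [hx.1], by linarith [hx.2]⟩).1).hasDerivWithinAt)
      (fun x hx => hb x hx) (left_mem_Icc.2 zero_le_one) hy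
    rw [hH0, sub_zero, Real.norm_of_nonneg hy.1] at this
    linarith [(abs_le.1 this).1]
  have hex : ∃ α ∈ Icc A B, emdenSnd (H1 α) 0 = 0 := by
    refine hB (fun α => emdenFst m (H α)) (fun α => emdenSnd (H1 α)) ?_ ?_ ?_ ?_ ?_
    · have h1 : Continuous fun q : ℝ × ℝ => H q.1 (Real.exp (2 * q.2)) :=
        hHc.comp (f := fun q : ℝ × ℝ => (q.1, Real.exp (2 * q.2))) (by fun_prop)
      have h2 : Continuous fun q : ℝ × ℝ => Real.log (1 + Real.exp (2 * q.2)) :=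
        Continuous.log (by fun_prop) fun q => by positivity
      unfold Function.uncurry emdenFst
      fun_prop
    · have h1 : Continuous fun q : ℝ × ℝ => H1 q.1 (Real.exp (2 * q.2)) :=
        hH1c.comp (f := fun q : ℝ × ℝ => (q.1, Real.exp (2 * q.2))) (by fun_prop)
      have h2 := continuous_emdenDamping
      unfold Function.uncurry emdenSnd
      fun_prop
    · intro α hα
      obtain ⟨-, -, H2, -, hd, heq⟩ := hH α (hIoc α hα)
      exact isEmdenSolution_of_profile (by linarith) hd heq _
    · exact fun α hα t ht => (hbounds α hα).1 t ht.2
    · intro α hα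
      have h1 := abs_le.1 (hbounds α hα).2
      have h2 := abs_emdenSnd_le (hIoc α hα).1.le (hH α (hIoc α hα)).2.1
      have h3 := Real.exp_le_exp.2 h1.2
      have h4 : emdenSnd (H1 α) (-α / 2 - 2) ^ 2 ≤ (2 * C + 2) ^ 2 := by
        rw [← sq_abs]
        exact pow_le_pow_left₀ (abs_nonneg _) h2 2
      unfold emdenEnergy
      gcongr
      linarith [h1.1]
  obtain ⟨α, hα, hα0⟩ := hex
  obtain ⟨-, -, H2, hH2c, hd, heq⟩ := hH α (hIoc α hα)
  refine ⟨α, hα.1, H α, H1 α, H2, hH0 α, ?_, hH2c, hd, heq⟩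
  -- At `t = 0` the damping vanishes, so `emdenSnd` reduces to `2 * H1 1`.
  simpa [emdenSnd, emdenDamping] using hα0

/-! ### Reflection across the equator and the variable `x = cos θ`. -/

theorem HasDerivAt.glue_zero {f g h : ℝ → ℝ} {d : ℝ} (hg : HasDerivAt g d 0)
    (hh : HasDerivAt h d 0) (hfg : ∀ x, 0 ≤ x → f x = g x) (hfh : ∀ x, x ≤ 0 → f x = h x) :
    HasDerivAt f d 0 := by
  have h1 : HasDerivWithinAt f d (Ici 0) 0 :=
    hg.hasDerivWithinAt.congr (fun x hx => hfg x hx) (hfg 0 le_rfl)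
  have h2 : HasDerivWithinAt f d (Iic 0) 0 :=
    hh.hasDerivWithinAt.congr (fun x hx => hfh x hx) (hfh 0 le_rfl)
  have h3 := h2.union h1
  rwa [Iic_union_Ici, hasDerivWithinAt_univ] at h3

/-- The even reflection of a `C²` function whose derivative vanishes at `0` is `C²`. -/
theorem hasDerivAt_even_reflection {G G1 G2 : ℝ → ℝ} {b : ℝ}
    (hd : ∀ x ∈ Ico (0 : ℝ) b, HasDerivAt G (G1 x) x ∧ HasDerivAt G1 (G2 x) x) (h0 : G1 0 = 0) :
    ∃ P1 : ℝ → ℝ, (∀ x, 0 ≤ x → P1 x = G1 x) ∧ (∀ x, x ≤ 0 → P1 x = -G1 (-x)) ∧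
      ∀ x ∈ Ioo (-b) b, HasDerivAt (fun x => G |x|) (P1 x) x ∧ HasDerivAt P1 (G2 |x|) x := by
  have hP1 : ∀ x : ℝ, x ≤ 0 → (if 0 ≤ x then G1 x else -G1 (-x)) = -G1 (-x) := by
    intro x hx
    split_ifs with h
    · rw [le_antisymm hx h]; simp [h0]
    · rfl
  refine ⟨fun x => if 0 ≤ x then G1 x else -G1 (-x), fun x hx => if_pos hx, hP1, ?_⟩
  have hneg : ∀ x, -b < x → x ≤ 0 → HasDerivAt (fun x => G (-x)) (-G1 (-x)) x ∧
      HasDerivAt (fun x => -G1 (-x)) (G2 (-x)) x := by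
    intro x hx hx0
    obtain ⟨h1, h2⟩ := hd (-x) ⟨by linarith, by linarith⟩
    have hn : HasDerivAt (fun x : ℝ => -x) (-1) x := hasDerivAt_neg x
    exact ⟨(h1.comp x hn).congr_deriv (by ring), ((h2.comp x hn).neg).congr_deriv (by ring)⟩
  intro x hx
  rcases lt_trichotomy x 0 with h | h | h
  · obtain ⟨h1, h2⟩ := hneg x hx.1 h.le
    beta_reduce
    rw [abs_of_neg h, hP1 x h.le]
    constructor
    · refine h1.congr_of_eventuallyEq ?_
      filter_upwards [Iio_mem_nhds h] with z hz
      rw [abs_of_neg hz]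
    · refine h2.congr_of_eventuallyEq ?_
      filter_upwards [Iio_mem_nhds h] with z hz using hP1 z (le_of_lt hz)
  · subst h
    obtain ⟨h1, h2⟩ := hd 0 ⟨le_rfl, hx.2⟩
    obtain ⟨h3, h4⟩ := hneg 0 hx.1 le_rfl
    simp only [neg_zero, h0] at h1 h2 h3 h4
    simp only [le_refl, if_true, h0, abs_zero]
    constructor
    · refine h1.glue_zero h3 (fun x hx => by rw [abs_of_nonneg hx]) fun x hx => by
        rw [abs_of_nonpos hx]
    · exact h2.glue_zero h4 (fun x hx => if_pos hx) hP1
  · obtain ⟨h1, h2⟩ := hd x ⟨h.le, hx.2⟩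
    beta_reduce
    rw [abs_of_pos h, if_pos h.le]
    constructor
    · refine h1.congr_of_eventuallyEq ?_
      filter_upwards [Ioi_mem_nhds h] with z hz
      rw [abs_of_pos hz]
    · refine h2.congr_of_eventuallyEq ?_
      filter_upwards [Ioi_mem_nhds h] with z hz using if_pos (le_of_lt hz)

theorem contDiffOn_two_of_hasDerivAt {P P1 P2 : ℝ → ℝ} {s : Set ℝ} (hs : IsOpen s)
    (h1 : ∀ x ∈ s, HasDerivAt P (P1 x) x) (h2 : ∀ x ∈ s, HasDerivAt P1 (P2 x) x)
    (hc : ContinuousOn P2 s) : ContDiffOn ℝ 2 P s := by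
  have hP1 : ContDiffOn ℝ 1 P1 s := by
    rw [show (1 : WithTop ℕ∞) = 0 + 1 from rfl, contDiffOn_succ_iff_deriv_of_isOpen hs]
    refine ⟨fun x hx => (h2 x hx).differentiableAt.differentiableWithinAt, by simp, ?_⟩
    rw [contDiffOn_zero]
    exact hc.congr fun x hx => (h2 x hx).deriv
  rw [show (2 : WithTop ℕ∞) = 1 + 1 from rfl, contDiffOn_succ_iff_deriv_of_isOpen hs]
  refine ⟨fun x hx => (h1 x hx).differentiableAt.differentiableWithinAt, by simp, ?_⟩
  exact hP1.congr fun x hx => (h1 x hx).deriv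

/-- An even profile in the variable `x = cos θ` which solves the equation on the sphere of
dimension `m + 2`. -/
structure IsLatitudeProfile (m : ℕ) (P P1 P2 : ℝ → ℝ) : Prop where
  even : ∀ x, P (-x) = P x
  hasDerivAt_fst : ∀ x ∈ Ioo (-3 : ℝ) 3, HasDerivAt P (P1 x) x
  hasDerivAt_snd : ∀ x ∈ Ioo (-3 : ℝ) 3, HasDerivAt P1 (P2 x) x
  contDiffOn : ContDiffOn ℝ 2 P (Ioo (-3) 3)
  equation : ∀ x ∈ Icc (-1 : ℝ) 1, (1 - x ^ 2) * P2 x - (m + 2) * x * P1 x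
    + 2 * (m + 1) * (Real.exp (P x) - 1) = 0

theorem exists_isLatitudeProfile {m : ℕ} (hm : 1 ≤ m) (hm7 : m ≤ 7) {A : ℝ} (hA : 0 < A) :
    ∃ α ≥ A, ∃ P P1 P2 : ℝ → ℝ, P 1 = α ∧ IsLatitudeProfile m P P1 P2 := by
  obtain ⟨α, hα, H, H1, H2, hH0, hH1, hH2c, hd, heq⟩ := exists_critical_profile hm hm7 hA
  let Y : ℝ → ℝ := fun x => (1 - x) / (1 + x)
  let G1 : ℝ → ℝ := fun x => H1 (Y x) * (-2 / (1 + x) ^ 2)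
  let G2 : ℝ → ℝ := fun x => H2 (Y x) * (-2 / (1 + x) ^ 2) * (-2 / (1 + x) ^ 2) +
    H1 (Y x) * (4 / (1 + x) ^ 3)
  -- The bound `x < 3` corresponds to `Y x > -1 / 2`; it puts the poles `x = ±1` in the interior of
  -- the domain.
  have hYm : ∀ x ∈ Ico (0 : ℝ) 3, Y x ∈ Ioo (-1 / 2 : ℝ) 2 := by
    intro x hx
    have : 0 < 1 + x := by linarith [hx.1]
    simp only [Y]
    constructor
    · rw [lt_div_iff₀ this]; linarith [hx.2]
    · rw [div_lt_iff₀ this]; linarith [hx.1]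
  have hY : ∀ x ∈ Ico (0 : ℝ) 3, HasDerivAt Y (-2 / (1 + x) ^ 2) x := by
    intro x hx
    have h0 : 1 + x ≠ 0 := by linarith [hx.1]
    refine (((hasDerivAt_id x).const_sub 1).div ((hasDerivAt_id x).const_add 1) h0).congr_deriv ?_
    simp only [id]
    field_simp
    ring
  have hY2 : ∀ x ∈ Ico (0 : ℝ) 3,
      HasDerivAt (fun x : ℝ => -2 / (1 + x) ^ 2) (4 / (1 + x) ^ 3) x := by
    intro x hx
    have h0 : 1 + x ≠ 0 := by linarith [hx.1]
    refine ((hasDerivAt_const x (-2 : ℝ)).div (((hasDerivAt_id x).const_add 1).pow 2)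
      (pow_ne_zero 2 h0)).congr_deriv ?_
    simp only [id, Pi.pow_apply]
    field_simp
    ring
  obtain ⟨P1, hP1, hP1', hP⟩ := hasDerivAt_even_reflection (G := fun x => H (Y x)) (G1 := G1)
    (G2 := G2) (b := 3) (fun x hx => ⟨(hd _ (hYm x hx)).1.comp x (hY x hx),
      ((hd _ (hYm x hx)).2.comp x (hY x hx)).mul (hY2 x hx)⟩) (by simp [G1, Y, hH1])
  have hmem : ∀ x ∈ Ioo (-3 : ℝ) 3, |x| ∈ Ico (0 : ℝ) 3 := fun x hx =>
    ⟨abs_nonneg x, abs_lt.2 hx⟩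
  have hP2c : ContinuousOn (fun x => G2 |x|) (Ioo (-3) 3) := by
    have h1 : ContinuousOn G2 (Ico 0 3) := by
      intro x hx
      have h0 : 1 + x ≠ 0 := by linarith [hx.1]
      have hYc := (hY x hx).continuousAt
      have hY2c := (hY2 x hx).continuousAt
      have hH1c : ContinuousAt (fun x => H1 (Y x)) x :=
        ContinuousAt.comp (g := H1) (hd _ (hYm x hx)).2.continuousAt hYc
      have hH2c' : ContinuousAt (fun x => H2 (Y x)) x :=
        ContinuousAt.comp (g := H2) hH2c.continuousAt hYc
      have h3 : ContinuousAt (fun x : ℝ => 4 / (1 + x) ^ 3) x :=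
        continuousAt_const.div (by fun_prop) (pow_ne_zero 3 h0)
      exact (((hH2c'.mul hY2c).mul hY2c).add (hH1c.mul h3)).continuousWithinAt
    exact h1.comp continuous_abs.continuousOn hmem
  refine ⟨α, hα, fun x => H (Y |x|), P1, fun x => G2 |x|, by simp [Y, hH0], ?_, ?_, ?_, ?_, ?_⟩
  · intro x
    rw [abs_neg]
  · exact fun x hx => (hP x hx).1
  · exact fun x hx => (hP x hx).2
  · exact contDiffOn_two_of_hasDerivAt isOpen_Ioo (fun x hx => (hP x hx).1)
      (fun x hx => (hP x hx).2) hP2c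
  · have key : ∀ x ∈ Icc (0 : ℝ) 1, (1 - x ^ 2) * G2 x - (m + 2) * x * G1 x
        + 2 * (m + 1) * (Real.exp (H (Y x)) - 1) = 0 := by
      intro x hx
      have h0 : 0 < 1 + x := by linarith [hx.1]
      have hYx : Y x ∈ Icc (0 : ℝ) 1 := by
        simp only [Y]
        exact ⟨div_nonneg (by linarith [hx.2]) h0.le, by rw [div_le_one h0]; linarith [hx.1]⟩
      rw [← heq _ hYx]
      simp only [G1, G2]
      generalize H1 (Y x) = u
      generalize H2 (Y x) = u'
      simp only [Y]
      field_simp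
      ring
    intro x hx
    rcases le_total 0 x with h | h
    · rw [abs_of_nonneg h, hP1 x h]
      exact key x ⟨h, hx.2⟩
    · have := key (-x) ⟨by linarith, by linarith [hx.1]⟩
      rw [abs_of_nonpos h, hP1' x h]
      linear_combination this

namespace IsLatitudeProfile

variable {m : ℕ} {P P1 P2 : ℝ → ℝ}

theorem isProfileSolution (h : IsLatitudeProfile m P P1 P2) :
    IsProfileSolution (m + 3) fun θ => P (Real.cos θ) := by
  have hcos : ∀ θ, Real.cos θ ∈ Ioo (-3 : ℝ) 3 := fun θ =>
    ⟨by linarith [Real.neg_one_le_cos θ], by linarith [Real.cos_le_one θ]⟩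
  have hs : ContDiff ℝ 2 fun θ => P (Real.cos θ) := by
    rw [← contDiffOn_univ]
    exact h.contDiffOn.comp Real.contDiff_cos.contDiffOn fun θ _ => hcos θ
  have hd1 : ∀ θ, HasDerivAt (fun θ => P (Real.cos θ)) (P1 (Real.cos θ) * -Real.sin θ) θ :=
    fun θ => (h.hasDerivAt_fst _ (hcos θ)).comp θ (Real.hasDerivAt_cos θ)
  have hd1' : deriv (fun θ => P (Real.cos θ)) = fun θ => P1 (Real.cos θ) * -Real.sin θ :=
    funext fun θ => (hd1 θ).deriv
  have hd2 : ∀ θ, HasDerivAt (fun θ => P1 (Real.cos θ) * -Real.sin θ)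
      (P2 (Real.cos θ) * -Real.sin θ * -Real.sin θ + P1 (Real.cos θ) * -Real.cos θ) θ :=
    fun θ => ((h.hasDerivAt_snd _ (hcos θ)).comp θ (Real.hasDerivAt_cos θ)).mul
      (Real.hasDerivAt_sin θ).neg
  refine ⟨(hs.of_le (by norm_num)).contDiffOn, hs.contDiffOn, fun θ hθ => ?_, ?_, ?_⟩
  · rw [hd1', (hd2 θ).deriv]
    have hsin := (Real.sin_pos_of_mem_Ioo hθ).ne'
    have e := h.equation (Real.cos θ) ⟨Real.neg_one_le_cos θ, Real.cos_le_one θ⟩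
    have hsc := Real.sin_sq_add_cos_sq θ
    push_cast
    have h1 : Real.cos θ / Real.sin θ * (P1 (Real.cos θ) * -Real.sin θ) =
        -(Real.cos θ * P1 (Real.cos θ)) := by field_simp
    rw [mul_assoc ((m : ℝ) + 3 - 2), h1]
    linear_combination e + P2 (Real.cos θ) * hsc
  · simpa using (hd1 0).hasDerivWithinAt
  · simpa using (hd1 Real.pi).hasDerivWithinAt

end IsLatitudeProfile

/-! ### The Laplacian on the sphere. -/

/-- The second derivative of a `C²` function in a direction, computed along a line. -/
theorem iteratedFDeriv_two_apply_of_hasDerivAt {E : Type*} [NormedAddCommGroup E]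
    [NormedSpace ℝ E] {f : E → ℝ} {x e : E} (hf : ContDiffAt ℝ 2 f x) {φ1 : ℝ → ℝ} {d : ℝ}
    (h1 : ∀ᶠ s in 𝓝 (0 : ℝ), HasDerivAt (fun s => f (x + s • e)) (φ1 s) s)
    (h2 : HasDerivAt φ1 d 0) : iteratedFDeriv ℝ 2 f x ![e, e] = d := by
  rw [iteratedFDeriv_two_apply]
  change fderiv ℝ (fderiv ℝ f) x e e = d
  have hline : ∀ s : ℝ, HasDerivAt (fun s : ℝ => x + s • e) e s := fun s => by
    simpa using ((hasDerivAt_id s).smul_const e).const_add x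
  have hx0 : x + (0 : ℝ) • e = x := by simp
  have hdiff : DifferentiableAt ℝ (fderiv ℝ f) (x + (0 : ℝ) • e) := by
    rw [hx0]
    exact (hf.fderiv_right (m := 1) (by norm_num)).differentiableAt one_ne_zero
  have h3 : HasDerivAt (fun s : ℝ => fderiv ℝ f (x + s • e)) (fderiv ℝ (fderiv ℝ f) x e) 0 := by
    have := hdiff.hasFDerivAt.comp_hasDerivAt (0 : ℝ) (hline 0)
    rwa [hx0] at this
  have h4 : HasDerivAt (fun s : ℝ => fderiv ℝ f (x + s • e) e)
      (fderiv ℝ (fderiv ℝ f) x e e) 0 := by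
    simpa using h3.clm_apply (hasDerivAt_const (0 : ℝ) e)
  have hev : ∀ᶠ y in 𝓝 x, DifferentiableAt ℝ f y := by
    filter_upwards [hf.eventually (by simp)] with y hy using hy.differentiableAt two_ne_zero
  have hev' : ∀ᶠ s in 𝓝 (0 : ℝ), DifferentiableAt ℝ f (x + s • e) := by
    have hc : Tendsto (fun s : ℝ => x + s • e) (𝓝 0) (𝓝 x) := by
      have := (hline 0).continuousAt.tendsto
      rwa [hx0] at this
    exact hc.eventually hev
  have h5 : φ1 =ᶠ[𝓝 0] fun s : ℝ => fderiv ℝ f (x + s • e) e := by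
    filter_upwards [h1, hev'] with s hs hs'
    exact hs.unique (hs'.hasFDerivAt.comp_hasDerivAt s (hline s))
  exact (h4.congr_of_eventuallyEq h5).unique h2

theorem homogeneousExtension_latitude_eventuallyEq {N : ℕ} (p σ : UnitSphere N) (P : ℝ → ℝ) :
    homogeneousExtension (fun τ : UnitSphere N => P (inner ℝ (p : EuclideanSpace ℝ (Fin N)) τ))
      =ᶠ[𝓝 (σ : EuclideanSpace ℝ (Fin N))]
        fun y => P (inner ℝ (p : EuclideanSpace ℝ (Fin N)) y / ‖y‖) := by
  have hσ : (σ : EuclideanSpace ℝ (Fin N)) ≠ 0 := ne_zero_of_mem_unit_sphere σ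
  filter_upwards [isOpen_ne.mem_nhds hσ] with y hy
  rw [homogeneousExtension, dif_pos hy]
  simp only [inner_smul_right]
  rw [inv_mul_eq_div]

theorem abs_inner_sphere_le {N : ℕ} (p σ : UnitSphere N) :
    |inner ℝ (p : EuclideanSpace ℝ (Fin N)) (σ : EuclideanSpace ℝ (Fin N))| ≤ 1 := by
  simpa using abs_real_inner_le_norm (p : EuclideanSpace ℝ (Fin N)) (σ : EuclideanSpace ℝ (Fin N))

/-- The Laplace–Beltrami operator of a function of the latitude `x = ⟪p, σ⟫`. -/
theorem sphereLaplacian_latitude {N : ℕ} (p σ : UnitSphere N) {P P1 P2 : ℝ → ℝ}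
    (h1 : ∀ x ∈ Ioo (-3 : ℝ) 3, HasDerivAt P (P1 x) x)
    (h2 : ∀ x ∈ Ioo (-3 : ℝ) 3, HasDerivAt P1 (P2 x) x)
    (hP : ContDiffOn ℝ 2 P (Ioo (-3) 3)) {x : ℝ}
    (hx : inner ℝ (p : EuclideanSpace ℝ (Fin N)) (σ : EuclideanSpace ℝ (Fin N)) = x) :
    sphereLaplacian (fun τ : UnitSphere N => P (inner ℝ (p : EuclideanSpace ℝ (Fin N)) τ)) σ =
      (1 - x ^ 2) * P2 x - (N - 1) * x * P1 x := by
  have hx1 : |x| ≤ 1 := hx ▸ abs_inner_sphere_le p σ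
  have hx3 : x ∈ Ioo (-3 : ℝ) 3 := abs_lt.1 (by linarith)
  have hσ : (σ : EuclideanSpace ℝ (Fin N)) ≠ 0 := ne_zero_of_mem_unit_sphere σ
  have hσ1 : ‖(σ : EuclideanSpace ℝ (Fin N))‖ = 1 := norm_eq_of_mem_sphere σ
  have hp1 : ‖(p : EuclideanSpace ℝ (Fin N))‖ = 1 := norm_eq_of_mem_sphere p
  set F : EuclideanSpace ℝ (Fin N) → ℝ :=
    fun y => P (inner ℝ (p : EuclideanSpace ℝ (Fin N)) y / ‖y‖) with hF
  have hFs : ContDiffAt ℝ 2 F σ := by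
    have hψ : ContDiffAt ℝ 2 (fun y : EuclideanSpace ℝ (Fin N) =>
        inner ℝ (p : EuclideanSpace ℝ (Fin N)) y / ‖y‖) σ :=
      (contDiffAt_const.inner ℝ contDiffAt_id).div (contDiffAt_norm ℝ hσ) (norm_ne_zero_iff.2 hσ)
    refine ContDiffAt.comp (g := P) _ ?_ hψ
    refine hP.contDiffAt (isOpen_Ioo.mem_nhds ?_)
    rw [hx, hσ1, div_one]
    exact hx3
  have hdir : ∀ e : EuclideanSpace ℝ (Fin N), ‖e‖ = 1 →
      iteratedFDeriv ℝ 2 F σ ![e, e] =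
        P2 x * (inner ℝ (p : EuclideanSpace ℝ (Fin N)) e -
          x * inner ℝ (σ : EuclideanSpace ℝ (Fin N)) e) ^ 2 +
        P1 x * (-2 * (inner ℝ (p : EuclideanSpace ℝ (Fin N)) e *
          inner ℝ (σ : EuclideanSpace ℝ (Fin N)) e) - x +
          3 * x * inner ℝ (σ : EuclideanSpace ℝ (Fin N)) e ^ 2) := by
    intro e he
    set a := inner ℝ (p : EuclideanSpace ℝ (Fin N)) e
    set b := inner ℝ (σ : EuclideanSpace ℝ (Fin N)) e
    -- This is `‖σ + s e‖`, since `σ` and `e` are unit vectors.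
    let n : ℝ → ℝ := fun s => √(1 + 2 * s * b + s ^ 2)
    have hr : ∀ s : ℝ, HasDerivAt (fun s : ℝ => 1 + 2 * s * b + s ^ 2) (2 * b + 2 * s) s := by
      intro s
      have e1 := (((((hasDerivAt_id s).const_mul 2).mul_const b).const_add 1).add
        (hasDerivAt_pow 2 s))
      refine e1.congr_deriv ?_
      simp
    have hn : ∀ s : ℝ, 0 < 1 + 2 * s * b + s ^ 2 → HasDerivAt n ((b + s) / n s) s := by
      intro s hs
      refine ((hr s).sqrt hs.ne').congr_deriv ?_
      have : 0 < n s := Real.sqrt_pos.2 hs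
      change _ / (2 * n s) = _
      field_simp
    have hnum : ∀ s : ℝ, HasDerivAt (fun s : ℝ => x + s * a) a s := fun s => by
      simpa using ((hasDerivAt_id s).mul_const a).const_add x
    have hψd : ∀ s : ℝ, 0 < 1 + 2 * s * b + s ^ 2 → HasDerivAt (fun s => (x + s * a) / n s)
        (a / n s - (x + s * a) * (b + s) / n s ^ 3) s := by
      intro s hs
      have : 0 < n s := Real.sqrt_pos.2 hs
      refine ((hnum s).div (hn s hs) this.ne').congr_deriv ?_
      field_simp
    have hline : ∀ s : ℝ, F (σ + s • e) = P ((x + s * a) / n s) := by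
      intro s
      have e1 : ‖(σ : EuclideanSpace ℝ (Fin N)) + s • e‖ = n s := by
        rw [← Real.sqrt_sq (norm_nonneg _), norm_add_sq_real, hσ1, norm_smul, he,
          inner_smul_right]
        simp only [n]
        congr 1
        simp only [Real.norm_eq_abs, mul_one, sq_abs]
        ring
      simp only [hF]
      rw [e1, inner_add_right, inner_smul_right, hx]
    have hn0 : n 0 = 1 := by simp [n]
    have hpos0 : 0 < 1 + 2 * (0 : ℝ) * b + 0 ^ 2 := by norm_num
    have hev1 : ∀ᶠ s in 𝓝 (0 : ℝ), 0 < 1 + 2 * s * b + s ^ 2 :=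
      (hr 0).continuousAt.eventually (lt_mem_nhds hpos0)
    have hev2 : ∀ᶠ s in 𝓝 (0 : ℝ), (x + s * a) / n s ∈ Ioo (-3 : ℝ) 3 := by
      refine (hψd 0 hpos0).continuousAt.eventually (isOpen_Ioo.mem_nhds ?_)
      simpa [hn0] using hx3
    refine iteratedFDeriv_two_apply_of_hasDerivAt hFs
      (φ1 := fun s => P1 ((x + s * a) / n s) * (a / n s - (x + s * a) * (b + s) / n s ^ 3)) ?_ ?_
    · filter_upwards [hev1, hev2] with s hs hs'
      simp only [hline]
      exact (h1 _ hs').comp s (hψd s hs)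
    · have hx0 : (x + 0 * a) / n 0 = x := by simp [hn0]
      have k1 : HasDerivAt (fun s => P1 ((x + s * a) / n s)) (P2 x * (a - x * b)) 0 := by
        have k := (h2 _ (by rw [hx0]; exact hx3)).comp 0 (hψd 0 hpos0)
        rw [hx0] at k
        refine k.congr_deriv ?_
        simp [hn0]
      have k2 := ((hasDerivAt_const (0 : ℝ) a).div (hn 0 hpos0) (by simp [hn0])).sub
        (((hnum 0).mul ((hasDerivAt_id (0 : ℝ)).const_add b)).div ((hn 0 hpos0).pow 3)
          (by simp [hn0]))
      refine (k1.mul k2).congr_deriv ?_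
      simp [hn0]
      ring
  rw [sphereLaplacian, InnerProductSpace.laplacian_congr_nhds
    (homogeneousExtension_latitude_eventuallyEq p σ P) |>.self_of_nhds]
  rw [InnerProductSpace.laplacian_eq_iteratedFDeriv_orthonormalBasis F
    (EuclideanSpace.basisFun (Fin N) ℝ)]
  beta_reduce
  set B := EuclideanSpace.basisFun (Fin N) ℝ
  rw [Finset.sum_congr rfl fun i _ => hdir (B i) (B.orthonormal.1 i)]
  have s1 : ∑ i, inner ℝ (p : EuclideanSpace ℝ (Fin N)) (B i) *
      inner ℝ (p : EuclideanSpace ℝ (Fin N)) (B i) = 1 := by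
    have := B.sum_inner_mul_inner (p : EuclideanSpace ℝ (Fin N)) p
    rw [real_inner_self_eq_norm_sq, hp1] at this
    simpa [real_inner_comm] using this
  have s2 : ∑ i, inner ℝ (σ : EuclideanSpace ℝ (Fin N)) (B i) *
      inner ℝ (σ : EuclideanSpace ℝ (Fin N)) (B i) = 1 := by
    have := B.sum_inner_mul_inner (σ : EuclideanSpace ℝ (Fin N)) σ
    rw [real_inner_self_eq_norm_sq, hσ1] at this
    simpa [real_inner_comm] using this
  have s3 : ∑ i, inner ℝ (p : EuclideanSpace ℝ (Fin N)) (B i) *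
      inner ℝ (σ : EuclideanSpace ℝ (Fin N)) (B i) = x := by
    rw [← hx, ← B.sum_inner_mul_inner]
    exact Finset.sum_congr rfl fun i _ => by rw [real_inner_comm (B i) (σ : EuclideanSpace ℝ (Fin N))]
  -- Parseval turns the sum of directional derivatives into inner products of `p` and `σ`; the term
  -- `-x P1`, independent of the direction, contributes the factor `N`.
  have hsum : ∀ a b : Fin N → ℝ, ∑ i, a i * a i = 1 → ∑ i, b i * b i = 1 → ∑ i, a i * b i = x →
      ∑ i, (P2 x * (a i - x * b i) ^ 2 + P1 x * (-2 * (a i * b i) - x + 3 * x * b i ^ 2)) =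
        (1 - x ^ 2) * P2 x - (N - 1) * x * P1 x := by
    intro a b ha hb hab
    have : ∀ i, P2 x * (a i - x * b i) ^ 2 + P1 x * (-2 * (a i * b i) - x + 3 * x * b i ^ 2) =
        P2 x * (a i * a i) - (2 * x * P2 x + 2 * P1 x) * (a i * b i) +
          (x ^ 2 * P2 x + 3 * x * P1 x) * (b i * b i) - x * P1 x := fun i => by ring
    simp only [this, Finset.sum_sub_distrib, Finset.sum_add_distrib, ← Finset.mul_sum, ha, hb, hab,
      Finset.sum_const, Finset.card_univ, Fintype.card_fin, nsmul_eq_mul]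
    ring
  exact hsum _ _ s1 s2 s3

theorem IsLatitudeProfile.isSphereSolution {m : ℕ} {P P1 P2 : ℝ → ℝ}
    (h : IsLatitudeProfile m P P1 P2) (p : UnitSphere (m + 3)) :
    IsSphereSolution (m + 3) fun σ : UnitSphere (m + 3) =>
      P (inner ℝ (p : EuclideanSpace ℝ (Fin (m + 3))) (σ : EuclideanSpace ℝ (Fin (m + 3)))) := by
  refine ⟨fun σ => ?_, fun σ => ?_⟩
  · have hmem : inner ℝ (p : EuclideanSpace ℝ (Fin (m + 3))) (σ : EuclideanSpace ℝ (Fin (m + 3))) ∈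
        Ioo (-3 : ℝ) 3 := abs_lt.1 (by linarith [abs_inner_sphere_le p σ])
    have h1 : ContDiffAt ℝ 2 (fun y => P (inner ℝ (p : EuclideanSpace ℝ (Fin (m + 3))) y))
        (σ : EuclideanSpace ℝ (Fin (m + 3))) :=
      ContDiffAt.comp (g := P) _ (h.contDiffOn.contDiffAt (isOpen_Ioo.mem_nhds hmem))
        (contDiffAt_const.inner ℝ contDiffAt_id)
    exact h1.contMDiffAt.comp σ (contMDiff_coe_sphere (n := m + 3 - 1) σ)
  · have hx : inner ℝ (p : EuclideanSpace ℝ (Fin (m + 3))) (σ : EuclideanSpace ℝ (Fin (m + 3))) ∈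
        Icc (-1 : ℝ) 1 := abs_le.1 (abs_inner_sphere_le p σ)
    rw [sphereLaplacian_latitude p σ h.hasDerivAt_fst h.hasDerivAt_snd h.contDiffOn rfl]
    have := h.equation _ hx
    push_cast
    linear_combination this

/-- A constant solution vanishes. -/
theorem IsSphereSolution.eq_zero_of_const {N : ℕ} [NeZero N] (hN : 2 < N) {V : UnitSphere N → ℝ}
    (h : IsSphereSolution N V) {c : ℝ} (hc : ∀ σ, V σ = c) (p : UnitSphere N) : c = 0 := by
  have h1 : homogeneousExtension V =ᶠ[𝓝 (p : EuclideanSpace ℝ (Fin N))] fun _ => c := by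
    filter_upwards [isOpen_ne.mem_nhds (ne_zero_of_mem_unit_sphere p)] with y hy
    rw [homogeneousExtension, dif_pos hy, hc]
  have h2 := h.equation p
  rw [sphereLaplacian, (InnerProductSpace.laplacian_congr_nhds h1).self_of_nhds,
    hc] at h2
  have h3 : Laplacian.laplacian (fun _ : EuclideanSpace ℝ (Fin N) => c) p = 0 := by simp
  rw [h3, zero_add] at h2
  have hN' : (2 : ℝ) < N := by exact_mod_cast hN
  have h4 : Real.exp c - 1 = 0 := (mul_eq_zero.1 h2).resolve_left (by linarith)
  exact Real.exp_eq_one_iff c |>.1 (by linarith)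

/-! ### The sequence of solutions. -/

theorem exists_strictMono_tendsto_atTop {S : ℝ → Prop} (h : ∀ A > 0, ∃ α ≥ A, S α) :
    ∃ α : ℕ → ℝ, StrictMono α ∧ Tendsto α atTop atTop ∧ (∀ j, 0 < α j) ∧ ∀ j, S (α j) := by
  choose! c hc hS using h
  -- Asking for a value beyond `α n + 1` at each step gives both strict growth and divergence.
  let α : ℕ → ℝ := fun n => Nat.rec (c 1) (fun _ a => c (a + 1)) n
  have hsucc : ∀ n, α (n + 1) = c (α n + 1) := fun n => rfl
  have hge : ∀ n : ℕ, (n : ℝ) + 1 ≤ α n := by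
    intro n
    induction n with
    | zero =>
      have : (1 : ℝ) ≤ α 0 := hc 1 one_pos
      simpa using this
    | succ n ih =>
      have : (0 : ℝ) < α n + 1 := by linarith [Nat.cast_nonneg (α := ℝ) n]
      have := hc _ this
      rw [hsucc]
      push_cast
      linarith
  have hpos : ∀ n, 0 < α n := fun n => lt_of_lt_of_le (by positivity) (hge n)
  refine ⟨α, strictMono_nat_of_lt_succ fun n => ?_, ?_, hpos, fun n => ?_⟩
  · have := hc (α n + 1) (by linarith [hpos n])
    rw [hsucc]
    linarith
  · exact tendsto_atTop_mono (fun n => by linarith [hge n]) tendsto_natCast_atTop_atTop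
  · cases n with
    | zero => exact hS 1 one_pos
    | succ n => exact hS _ (by linarith [hpos n])

theorem theoremB (N : ℕ) [NeZero N] (hN4 : 4 ≤ N) (hN10 : N ≤ 10) (p : UnitSphere N) :
    ∃ (α : ℕ → ℝ) (v : ℕ → ℝ → ℝ) (V : ℕ → UnitSphere N → ℝ),
      StrictMono α ∧ Filter.Tendsto α Filter.atTop Filter.atTop ∧
      Function.Injective V ∧
      ∀ j : ℕ,
        IsSphereSolution N (V j) ∧
        (∃ σ τ : UnitSphere N, V j σ ≠ V j τ) ∧
        (∀ σ : UnitSphere N, V j σ = v j (polarAngle p σ)) ∧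
        (∀ θ ∈ Set.Icc 0 Real.pi, v j (Real.pi - θ) = v j θ) ∧
        IsProfileSolution N (v j) ∧
        v j 0 = α j := by
  obtain ⟨m, rfl⟩ : ∃ m, N = m + 3 := ⟨N - 3, by omega⟩
  obtain ⟨α, hmono, htend, hpos, hα⟩ := exists_strictMono_tendsto_atTop fun A hA =>
    exists_isLatitudeProfile (m := m) (by omega) (by omega) hA
  choose P P1 P2 hP1 hP using hα
  have hpp : inner ℝ (p : EuclideanSpace ℝ (Fin (m + 3))) (p : EuclideanSpace ℝ (Fin (m + 3))) = 1 := by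
    rw [real_inner_self_eq_norm_sq, norm_eq_of_mem_sphere p]; norm_num
  refine ⟨α, fun j θ => P j (Real.cos θ), fun j σ => P j (inner ℝ
    (p : EuclideanSpace ℝ (Fin (m + 3))) (σ : EuclideanSpace ℝ (Fin (m + 3)))), hmono, htend, ?_,
    fun j => ⟨(hP j).isSphereSolution p, ?_, fun σ => ?_, fun θ _ => ?_,
      (hP j).isProfileSolution, ?_⟩⟩
  -- The value of `V j` at `p` is `α j`, which separates the solutions.
  · intro i j hij
    have := congrFun hij p
    simp only [hpp, hP1] at this
    exact hmono.injective this
  -- A constant solution would be `0`, whereas the value at `p` is `α j > 0`.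
  · by_contra! hcon
    have := ((hP j).isSphereSolution p).eq_zero_of_const (by omega) (fun σ => hcon σ p) p
    rw [hpp, hP1] at this
    exact (hpos j).ne' this
  · beta_reduce
    rw [polarAngle, InnerProductGeometry.cos_angle, norm_eq_of_mem_sphere p,
      norm_eq_of_mem_sphere σ]
    norm_num
  · beta_reduce
    rw [Real.cos_pi_sub, (hP j).even]
  · simp [hP1]
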